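/- **Notation.** For a real matrix $A$ let $\|A\|$, $\|A\|_F$ and $\|A\|_\infty=\max_{i,j}|a_{ij}|$ be its spectral, Frobenius and entrywise maximum norm, and let $\operatorname{expit}(u)=e^u/(1+e^u)$. Fix integers $n_1,n_2\ge 1$ and $d_s,d_m,d_\theta\ge 0$ with $d=d_s+d_m+d_\theta\ge 1$. A pair $(M,\Theta)$ of real $n_1\times n_2$ matrices has *shared factor form* if $$M=\Lambda_{m1}F_s^\top+\Lambda_{m2}F_m^\top,\qquad \Theta=\Lambda_{\theta1}F_s^\top+\Lambda_{\theta2}F_\theta^\top,$$ where $F_s,F_m,F_\theta$ have $n_2$ rows and $d_s,d_m,d_\theta$ columns, the loadings have the matching sizes, $\Lambda_{m1}^\top\Lambda_{m1}+\Lambda_{\theta1}^\top\Lambda_{\theta1}$, $\Lambda_{m2}^\top\Lambda_{m2}$, $\Lambda_{\theta2}^\top\Lambda_{\theta2}$ are diagonal, $\frac1{n_2}F_\cdot^\top F_\cdot=I$ for each factor, $F_s^\top F_m=0$, $F_s^\top F_\theta=0$ and $\|\frac1{n_2}F_m^\top F_\theta\|<1$. **Assumptions.** (a) $(M_\star,\Theta_\star)$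 has shared factor form. The $w_{ij}$ are mutually independent Bernoulli variables with parameters $\pi_{\star,ij}=\operatorname{expit}(\theta_{\star,ij})$, the real random variables $x_{ij}$ are mutually independent with laws $\mathcal P_{ij}(m_{\star,ij})$, and the family $(w_{ij})$ is independent of the family $(x_{ij})$. (b) $\|M_\star\|_\infty\le\alpha_m$, $\|\Theta_\star\|_\infty\le\alpha_\theta$, and $0<\eta<\infty$. (c) The functions $l_{ij}(x,m)$ (which may depend on the type of the entry $(i,j)$) are measurable in $x$ and differentiable in $m$, with derivative $l_{ij}'=\partial l_{ij}/\partial m$. There are $\alpha_l,L_l>0$ such that for all $i,j$ and all $m\in[-\alpha_m,\alpha_m]$ the variable $l_{ij}(x_{ij},m)$ is integrable and $$\pi_{\star,ij}\{\mathbb E[l_{ij}(x_{ij},m_{\star,ij})]-\mathbb E[l_{ij}(x_{ij},m)]\}\ge\alpha_l(m-m_{\star,ij})^2,$$ and, almost surely, $|l_{ij}'(x_{ij},m)-l_{ij}'(x_{ij},m')|\le L_l|m-m'|$ for all $i,j$ and all $m,m'\in[-\alpha_m,\alpha_m]$. (d4) There are $\delta,\alpha_\delta>0$ with $\max_{i,j}\big(\mathbb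 E|l_{ij}'(x_{ij},m_{\star,ij})|^{4+\delta}\big)^{1/(4+\delta)}\le\alpha_\delta$ and $$\frac{L_l}{(n_1+n_2)^2}+\frac{\max\{\alpha_\delta,1/\eta\}(4+\delta)}{3+\delta}\frac{\sqrt{n_1n_2}}{(n_1+n_2)^{3/2}}\le\frac12\min\Big\{\frac{e^{\alpha_\theta}}{2\eta(1+e^{\alpha_\theta})^2},\alpha_l\Big\}.$$ Moreover $(\hat M_o,\hat\Theta_o)$ is a (measurable) random pair that, almost surely, minimizes $$\mathcal L(M,\Theta,\eta)=-\sum_{i,j}\big\{w_{ij}\big(\log\operatorname{expit}(\theta_{ij})+\eta\, l_{ij}(x_{ij},m_{ij})\big)+(1-w_{ij})\log(1-\operatorname{expit}(\theta_{ij}))\big\}$$ over all pairs $(M,\Theta)$ of shared factor form with $\|M\|_\infty\le\alpha_m$, $\|\Theta\|_\infty\le\alpha_\theta$. (This includes every minimizer over all pairs of shared factor form that satisfies these two bounds.) Put $H=(M^\top,\Theta^\top)^\top$, $\Delta=\hat H_o-H_\star$, and $$\alpha_h=\min\Big\{\frac{e^{\alpha_\theta}}{2(1+e^{\alpha_\theta})^2},\eta\alpha_l\Big\},\qquad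 c_\delta=\max\{\eta\alpha_\delta+2\eta L_l\alpha_m,1\}.$$ **Lemma.** There exist universal constants $C_1,C_2>0$ such that under (a), (b), (c), (d4), for every $c>0$: 1. for every $t>(n_1+n_2)^{-\delta/2}$, $$\mathbb P(\|\Delta\|_F\ge t)\le\mathbb P\Big(\Delta\ne0,\ \frac{\|\Delta\|_F}{(n_1+n_2)\|\Delta\|_\infty}<c\Big)+\frac{n_1n_2}{(n_1+n_2)^{2+\delta/2}}+C_1\exp\Big(-C_2\frac{\alpha_h\,c}{c_\delta d^{3/2}(n_1+n_2)^{1/2}}\,t\Big);$$ 2. for every $t\ge1$ (the ratio being read as $0$ when $\Delta=0$), $$\mathbb P\Big(\frac{\|\Delta\|_F^{2+c}}{(n_1+n_2)^{1+c}\|\Delta\|_\infty^{1+c}}\ge t\Big)\le\frac{n_1n_2}{(n_1+n_2)^{2+\delta/2}}+C_1\Big(c+\frac1c\Big)\exp\Big(-C_2\frac{\alpha_h}{c_\delta d^{3/2}(n_1+n_2)^{1/2}}\Big(\frac t2\Big)^{2/(2+c)}\Big).$$ -/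

import Mathlib

open MeasureTheory ProbabilityTheory Matrix

noncomputable section

namespace SharedFactor

/-- The Frobenius norm. -/
def frob {ι κ : Type*} [Fintype ι] [Fintype κ] (A : Matrix ι κ ℝ) : ℝ :=
  Real.sqrt (∑ i, ∑ j, A i j ^ 2)

/-- The entrywise maximum norm. -/
def maxNorm {ι κ : Type*} [Fintype ι] [Fintype κ] (A : Matrix ι κ ℝ) : ℝ :=
  ⨆ p : ι × κ, |A p.1 p.2|

open scoped Matrix.Norms.L2Operator in
/-- `(M, Θ)` has the shared factor form
`M = Λm1 Fsᵀ + Λm2 Fmᵀ`, `Θ = Λθ1 Fsᵀ + Λθ2 Fθᵀ`, with factors and loadings subject to the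
identification constraints; the norm in the last clause is the spectral norm. -/
def HasSharedFactorForm {n₁ n₂ : ℕ} (ds dm dθ : ℕ) (M Θ : Matrix (Fin n₁) (Fin n₂) ℝ) : Prop :=
  ∃ (Λm1 Λθ1 : Matrix (Fin n₁) (Fin ds) ℝ) (Λm2 : Matrix (Fin n₁) (Fin dm) ℝ)
    (Λθ2 : Matrix (Fin n₁) (Fin dθ) ℝ) (Fs : Matrix (Fin n₂) (Fin ds) ℝ)
    (Fm : Matrix (Fin n₂) (Fin dm) ℝ) (Fθ : Matrix (Fin n₂) (Fin dθ) ℝ),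
    M = Λm1 * Fsᵀ + Λm2 * Fmᵀ ∧
    Θ = Λθ1 * Fsᵀ + Λθ2 * Fθᵀ ∧
    (Λm1ᵀ * Λm1 + Λθ1ᵀ * Λθ1).IsDiag ∧ (Λm2ᵀ * Λm2).IsDiag ∧ (Λθ2ᵀ * Λθ2).IsDiag ∧
    (1 / (n₂ : ℝ)) • (Fsᵀ * Fs) = 1 ∧ (1 / (n₂ : ℝ)) • (Fmᵀ * Fm) = 1 ∧
    (1 / (n₂ : ℝ)) • (Fθᵀ * Fθ) = 1 ∧
    Fsᵀ * Fm = 0 ∧ Fsᵀ * Fθ = 0 ∧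
    ‖(1 / (n₂ : ℝ)) • (Fmᵀ * Fθ)‖ < 1

/-- The pairs over which the estimator is chosen: shared factor form, and entries of `M` and `Θ`
bounded by `αm` and `αθ`. -/
def Admissible {n₁ n₂ : ℕ} (ds dm dθ : ℕ) (αm αθ : ℝ)
    (M Θ : Matrix (Fin n₁) (Fin n₂) ℝ) : Prop :=
  HasSharedFactorForm ds dm dθ M Θ ∧ maxNorm M ≤ αm ∧ maxNorm Θ ≤ αθ

/-- The negative pseudo-log-likelihood of `(M, Θ)` at the data `(w, x)`; `Real.sigmoid` is
`expit`. -/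
def negLogLik {n₁ n₂ : ℕ} (l : Fin n₁ → Fin n₂ → ℝ → ℝ → ℝ) (η : ℝ)
    (w x : Fin n₁ → Fin n₂ → ℝ) (M Θ : Matrix (Fin n₁) (Fin n₂) ℝ) : ℝ :=
  -∑ i, ∑ j, (w i j * (Real.log (Real.sigmoid (Θ i j)) + η * l i j (x i j) (M i j))
    + (1 - w i j) * Real.log (1 - Real.sigmoid (Θ i j)))

/-- The model: the true pair has the shared factor form, the `w i j` are independent
Bernoulli with parameter `expit (Θ i j)`, the `x i j` are independent with law `P i j (M i j)`,
and the family `w` is independent of the family `x`. -/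
structure Model {n₁ n₂ : ℕ} {Ω : Type*} [MeasurableSpace Ω] (μ : Measure Ω)
    (ds dm dθ : ℕ) (P : Fin n₁ → Fin n₂ → ℝ → Measure ℝ)
    (M Θ : Matrix (Fin n₁) (Fin n₂) ℝ) (w x : Fin n₁ → Fin n₂ → Ω → ℝ) : Prop where
  form : HasSharedFactorForm ds dm dθ M Θ
  measurable_w : ∀ i j, Measurable (w i j)
  measurable_x : ∀ i j, Measurable (x i j)
  law_w : ∀ i j, HasLaw (w i j) (bernoulliMeasure 1 0 (unitInterval.sigmoid (Θ i j))) μ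
  law_x : ∀ i j, HasLaw (x i j) (P i j (M i j)) μ
  indep_w : iIndepFun (fun (p : Fin n₁ × Fin n₂) => w p.1 p.2) μ
  indep_x : iIndepFun (fun (p : Fin n₁ × Fin n₂) => x p.1 p.2) μ
  indep_w_x : IndepFun (fun ω (p : Fin n₁ × Fin n₂) => w p.1 p.2 ω)
    (fun ω (p : Fin n₁ × Fin n₂) => x p.1 p.2 ω) μ

/-- Boundedness of the true parameters and of the weight. -/
structure Bounded {n₁ n₂ : ℕ} (M Θ : Matrix (Fin n₁) (Fin n₂) ℝ) (αm αθ η : ℝ) : Prop where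
  bound_M : maxNorm M ≤ αm
  bound_Θ : maxNorm Θ ≤ αθ
  weight_pos : 0 < η

/-- Regularity of the pseudo-log-likelihood: quadratic lower bound on the expected excess loss,
and a derivative in `m` that is Lipschitz on `[-αm, αm]` at the data. -/
structure LossRegular {n₁ n₂ : ℕ} {Ω : Type*} [MeasurableSpace Ω] (μ : Measure Ω)
    (l : Fin n₁ → Fin n₂ → ℝ → ℝ → ℝ) (M Θ : Matrix (Fin n₁) (Fin n₂) ℝ)
    (x : Fin n₁ → Fin n₂ → Ω → ℝ) (αm αl L : ℝ) : Prop where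
  pos_αl : 0 < αl
  pos_L : 0 < L
  measurable_l : ∀ i j m, Measurable (fun y => l i j y m)
  integrable_l : ∀ i j, ∀ m ∈ Set.Icc (-αm) αm, Integrable (fun ω => l i j (x i j ω) m) μ
  excess : ∀ i j, ∀ m ∈ Set.Icc (-αm) αm,
    αl * (m - M i j) ^ 2 ≤ Real.sigmoid (Θ i j) *
      (∫ ω, l i j (x i j ω) (M i j) ∂μ - ∫ ω, l i j (x i j ω) m ∂μ)
  differentiable_l : ∀ i j y, Differentiable ℝ (l i j y)
  lipschitz : ∀ᵐ ω ∂μ, ∀ i j, ∀ m ∈ Set.Icc (-αm) αm, ∀ m' ∈ Set.Icc (-αm) αm,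
    |deriv (l i j (x i j ω)) m - deriv (l i j (x i j ω)) m'| ≤ L * |m - m'|

/-- The `4 + δ` moment bound on the derivative at the truth, with the accompanying inequality
between the constants. -/
structure MomentBound {n₁ n₂ : ℕ} {Ω : Type*} [MeasurableSpace Ω] (μ : Measure Ω)
    (l : Fin n₁ → Fin n₂ → ℝ → ℝ → ℝ) (M : Matrix (Fin n₁) (Fin n₂) ℝ)
    (x : Fin n₁ → Fin n₂ → Ω → ℝ) (αθ αl L η δ αδ : ℝ) : Prop where
  pos_δ : 0 < δ
  pos_αδ : 0 < αδ
  moment : ∀ i j, eLpNorm (fun ω => deriv (l i j (x i j ω)) (M i j)) (ENNReal.ofReal (4 + δ)) μ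
    ≤ ENNReal.ofReal αδ
  constants : L / ((n₁ : ℝ) + n₂) ^ 2
      + max αδ (1 / η) * (4 + δ) / (3 + δ) *
        (Real.sqrt ((n₁ : ℝ) * n₂) / ((n₁ : ℝ) + n₂) ^ (3 / 2 : ℝ))
    ≤ 1 / 2 * min (Real.exp αθ / (2 * η * (1 + Real.exp αθ) ^ 2)) αl

/-- `(Mhat, Θhat)` is a random minimizer of the negative pseudo-log-likelihood over the
admissible pairs. In particular a minimizer over all pairs of shared factor form is one,
as soon as it satisfies the entrywise bounds. -/
structure IsEstimator {n₁ n₂ : ℕ} {Ω : Type*} [MeasurableSpace Ω] (μ : Measure Ω)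
    (ds dm dθ : ℕ) (αm αθ η : ℝ) (l : Fin n₁ → Fin n₂ → ℝ → ℝ → ℝ)
    (w x : Fin n₁ → Fin n₂ → Ω → ℝ) (Mhat Θhat : Ω → Matrix (Fin n₁) (Fin n₂) ℝ) : Prop where
  measurable_M : ∀ i j, Measurable (fun ω => Mhat ω i j)
  measurable_Θ : ∀ i j, Measurable (fun ω => Θhat ω i j)
  minimizes : ∀ᵐ ω ∂μ, Admissible ds dm dθ αm αθ (Mhat ω) (Θhat ω) ∧
    ∀ M Θ, Admissible ds dm dθ αm αθ M Θ →
      negLogLik l η (fun i j => w i j ω) (fun i j => x i j ω) (Mhat ω) (Θhat ω)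
        ≤ negLogLik l η (fun i j => w i j ω) (fun i j => x i j ω) M Θ

/-- The error `Ĥ - H⋆` of the stacked matrix `H = (Mᵀ, Θᵀ)ᵀ`. -/
def err {n₁ n₂ : ℕ} {Ω : Type*} (Mhat Θhat : Ω → Matrix (Fin n₁) (Fin n₂) ℝ)
    (M Θ : Matrix (Fin n₁) (Fin n₂) ℝ) (ω : Ω) : Matrix (Fin n₁ ⊕ Fin n₁) (Fin n₂) ℝ :=
  fromRows (Mhat ω) (Θhat ω) - fromRows M Θ

/-- The curvature constant `α_h`. -/
def αh (αθ η αl : ℝ) : ℝ :=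
  min (Real.exp αθ / (2 * (1 + Real.exp αθ) ^ 2)) (η * αl)

/-- The scale constant `c_δ`. -/
def cδ (η αδ L αm : ℝ) : ℝ :=
  max (η * αδ + 2 * η * L * αm) 1

end SharedFactor

end

/-!
The estimator minimizes the objective, so the objective does not increase from the true pair to
`(Mhat, Θhat)`. Its mean increases by at least `α_h ‖Δ‖_F ^ 2`: in `Θ` by strong convexity of
`-log (1 - expit θ)` (`log_one_sub_sigmoid_curvature`), in `M` by the excess assumption. Hence two
centred sums of independent variables, one of increments of the loss and one linear in
`Θhat - Θ`, together exceed the curvature at the random point `Δ` (`curvature_le_process`).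

The increments of the loss have a random Lipschitz constant governed by its derivative at the
truth, which has only `4 + δ` moments. The increments are therefore truncated where that derivative
exceeds `α_δ √N`, with `N = n₁ + n₂`. By Markov's inequality some entry is truncated with
probability at most `n₁ n₂ / N ^ (2 + δ / 2)` (`measureReal_exists_not_truncated_le`), and the
inequality between the constants says that the bias of the truncation costs at most half of the
curvature once `‖Δ‖_F ≥ N ^ (-δ / 2)` (`bias_le_half_curvature`).

Both centred sums are suprema over matrices of rank at most `2 d` with bounded entries, and
`measure_process_ge_le` bounds their tails without chaining. Coordinate by coordinate, the
exponential moment of the supremum is symmetrized and contracted to a linear process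
(`lintegral_exp_iSup_symmetrize`, `lintegral_exp_iSup_sum_le`). A matrix of rank at most `r` with
entries at most `b` is a sum of `r` outer products of vectors with entries at most `1` and `b`, by
choosing a maximal-determinant set of rows (`exists_bounded_factorization`), so a linear functional
of it is at most `r b` times the maximum over `2 ^ N` pairs of sign vectors. The union over these
pairs costs a factor `exp N`, and the step in the exponential moment is chosen so that the
variance term costs no more (`tail_constant_le`).

If `‖Δ‖_F` is about `s` and `c N ‖Δ‖_∞ ≤ ‖Δ‖_F`, the entries of `Δ` are at most `s / (c N)`, and the
curvature `s ^ 2` beats the fluctuations with an exponent linear in `s` (`measure_shell_le`).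
Summing over `s = 2 ^ k t` gives the first bound, in `measure_flat_le`. For the second, the ratio
`R = ‖Δ‖_F / (N ‖Δ‖_∞)` is at most `1` and the weighted error is `‖Δ‖_F R ^ (1 + c)`; on the range
where `R` is about `2 ^ (-k)` the first bound applies with `2 ^ (-k)` for `c` and
`2 ^ (k (1 + c)) t` for `t`, and the resulting exponents `2 ^ (k c) t` are summable in `k`, at the
price of a factor of order `c + 1 / c` (`measure_weighted_le`). The exponent so obtained is linear
in `t`, and `t` dominates `(t / 2) ^ (2 / (2 + c))` for `t ≥ 1`.
-/

noncomputable section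

namespace SharedFactor

open scoped ENNReal

/-! ### Contraction, and low-rank matrices as sums of bounded outer products -/

/-- The exponential sum is monotone under weak majorization of pairs. -/
theorem exp_add_exp_le_of_max_le {a b a' b' : ℝ} (hmax : max a b ≤ max a' b')
    (hsum : a + b ≤ a' + b') : Real.exp a + Real.exp b ≤ Real.exp a' + Real.exp b' := by
  wlog hab : b ≤ a generalizing a b
  · have := this (by rwa [max_comm]) (by linarith) (le_of_not_ge hab)
    linarith
  wlog hab' : b' ≤ a' generalizing a' b'
  · have := this (by rwa [max_comm b' a']) (by linarith) (le_of_not_ge hab')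
    linarith
  rw [max_eq_left hab, max_eq_left hab'] at hmax
  rcases le_or_gt b b' with h | h
  · exact add_le_add (Real.exp_le_exp.2 hmax) (Real.exp_le_exp.2 h)
  · -- the increment `b - b'` is paid for by `a' - a`, where the exponential is steeper
    have h1 : Real.exp b - Real.exp b' ≤ Real.exp b * (b - b') := by
      have := Real.add_one_le_exp (b' - b)
      have h2 : Real.exp b' = Real.exp b * Real.exp (b' - b) := by
        rw [← Real.exp_add]; congr 1; ring
      rw [h2]
      nlinarith [Real.exp_pos b]
    have h3 : Real.exp a * (a' - a) ≤ Real.exp a' - Real.exp a := by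
      have := Real.add_one_le_exp (a' - a)
      have h2 : Real.exp a' = Real.exp a * Real.exp (a' - a) := by
        rw [← Real.exp_add]; congr 1; ring
      rw [h2]
      nlinarith [Real.exp_pos a]
    have h4 : Real.exp b * (b - b') ≤ Real.exp a * (a' - a) :=
      mul_le_mul (Real.exp_le_exp.2 hab) (by linarith) (by linarith) (Real.exp_pos a).le
    linarith

/-- Contraction for the exponential moment of a supremum, averaged over one random sign: the value
increases when the family `φ` is replaced by a family `ψ` of larger absolute values and larger
increments. No convexity or monotonicity relates `φ` to `ψ`, so `φ` may be a nonlinear function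
of the index. -/
theorem exp_iSup_contraction {T : Type*} [Finite T] [Nonempty T] (h φ ψ : T → ℝ)
    (hφ : ∀ t, |φ t| ≤ |ψ t|) (hφψ : ∀ t t', |φ t - φ t'| ≤ |ψ t - ψ t'|) :
    Real.exp (⨆ t, (h t + φ t)) + Real.exp (⨆ t, (h t - φ t)) ≤
      Real.exp (⨆ t, (h t + ψ t)) + Real.exp (⨆ t, (h t - ψ t)) := by
  obtain ⟨t₁, h₁⟩ := exists_eq_ciSup_of_finite (f := fun t => h t + φ t)
  obtain ⟨t₂, h₂⟩ := exists_eq_ciSup_of_finite (f := fun t => h t - φ t)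
  have hp : ∀ t, h t + ψ t ≤ ⨆ t, (h t + ψ t) := fun t =>
    le_ciSup (f := fun t => h t + ψ t) (Set.finite_range _).bddAbove t
  have hm : ∀ t, h t - ψ t ≤ ⨆ t, (h t - ψ t) := fun t =>
    le_ciSup (f := fun t => h t - ψ t) (Set.finite_range _).bddAbove t
  have habs : ∀ t, h t + |ψ t| ≤ max (⨆ t, (h t + ψ t)) (⨆ t, (h t - ψ t)) := by
    intro t
    rcases abs_choice (ψ t) with h' | h' <;> rw [h']
    · exact (hp t).trans (le_max_left _ _)
    · exact (hm t).trans (le_max_right _ _)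
  rw [← h₁, ← h₂]
  apply exp_add_exp_le_of_max_le
  · apply max_le
    · exact (add_le_add_right ((le_abs_self _).trans (hφ t₁)) _).trans (habs t₁)
    · refine le_trans ?_ (habs t₂)
      linarith [neg_abs_le (φ t₂), hφ t₂]
  · have := (le_abs_self _).trans (hφψ t₁ t₂)
    rcases abs_choice (ψ t₁ - ψ t₂) with h' | h' <;> rw [h'] at this
    · linarith [hp t₁, hm t₂]
    · linarith [hp t₂, hm t₁]

/-- Cramer's rule for the determinant with respect to a basis. -/
theorem basis_det_update {ι V : Type*} [Fintype ι] [DecidableEq ι] [AddCommGroup V] [Module ℝ V]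
    (e : Module.Basis ι ℝ V) (k : ι) (x : V) :
    e.det (Function.update e k x) = e.repr x k := by
  have : e.det.toMultilinearMap.toLinearMap e k = e.coord k := by
    refine e.ext fun j => ?_
    simp only [MultilinearMap.toLinearMap_apply, AlternatingMap.coe_multilinearMap,
      Module.Basis.coord_apply, Module.Basis.repr_self]
    by_cases hj : j = k
    · subst hj
      simp [Function.update_eq_self, Module.Basis.det_self]
    · rw [AlternatingMap.map_update_self _ _ (Ne.symm hj), Finsupp.single_eq_of_ne (Ne.symm hj)]
  simpa using LinearMap.congr_fun this x

/-- A finite spanning family contains a basis in which every member of the family has coordinates in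
`[-1, 1]`: one that maximizes the absolute value of the determinant. -/
theorem exists_bounded_coordinates {ι V : Type*} [Finite ι] [AddCommGroup V] [Module ℝ V]
    [FiniteDimensional ℝ V] (a : ι → V) (ha : Submodule.span ℝ (Set.range a) = ⊤) :
    ∃ (σ : Fin (Module.finrank ℝ V) → ι) (c : ι → Fin (Module.finrank ℝ V) → ℝ),
      (∀ i k, |c i k| ≤ 1) ∧ ∀ i, a i = ∑ k, c i k • a (σ k) := by
  classical
  let B := Module.finBasis ℝ V
  obtain ⟨σ₀, hσ₀⟩ : ∃ σ₀ : Fin (Module.finrank ℝ V) → ι, B.det (a ∘ σ₀) ≠ 0 := by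
    let b' := Module.Basis.ofSpan ha.ge
    let b := b'.reindex (b'.indexEquiv B)
    have hb : ∀ k, ∃ i, a i = b k := by
      intro k
      have : b k ∈ Set.range b' := by
        rw [Module.Basis.reindex_apply]; exact Set.mem_range_self _
      exact Module.Basis.ofSpan_subset ha.ge this
    choose σ₀ h₀ using hb
    refine ⟨σ₀, ?_⟩
    have : a ∘ σ₀ = b := funext h₀
    rw [this]
    exact (B.isUnit_det b).ne_zero
  have : Nonempty (Fin (Module.finrank ℝ V) → ι) := ⟨σ₀⟩
  obtain ⟨σ, hσ⟩ := Finite.exists_max (fun σ : Fin (Module.finrank ℝ V) → ι => |B.det (a ∘ σ)|)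
  have hne : B.det (a ∘ σ) ≠ 0 := abs_pos.1 ((abs_pos.2 hσ₀).trans_le (hσ σ₀))
  obtain ⟨hli, hsp⟩ := (Module.Basis.is_basis_iff_det B).2 (isUnit_iff_ne_zero.2 hne)
  let e := Module.Basis.mk hli hsp.ge
  have he : (e : Fin (Module.finrank ℝ V) → V) = a ∘ σ := Module.Basis.coe_mk _ _
  refine ⟨σ, fun i k => e.repr (a i) k, fun i k => ?_, fun i => ?_⟩
  · -- Cramer's rule: the coordinate is a quotient of two of the compared determinants
    have h1 : B.det (Function.update e k (a i)) = B.det e * e.repr (a i) k := by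
      have := congrArg (fun f => f (Function.update e k (a i)))
        (AlternatingMap.eq_smul_basis_det e B.det)
      simpa [basis_det_update] using this
    have h2 : Function.update e k (a i) = a ∘ Function.update σ k i := by
      rw [he, Function.comp_update]
    have h3 := hσ (Function.update σ k i)
    simp only [← h2] at h3
    rw [h1, ← he, abs_mul] at h3
    rw [← he] at hne
    exact le_of_mul_le_mul_left (by simpa using h3) (abs_pos.2 hne)
  · conv_lhs => rw [← e.sum_repr (a i)]
    simp [he]

/-- A matrix of rank at most `r` with entries at most `b` is a sum of `r` outer products of vectors
with entries at most `1` and `b`: the rows are expanded in a maximal-determinant choice of rows. -/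
theorem exists_bounded_factorization {m n r : ℕ} {b : ℝ} (hb : 0 ≤ b)
    (A : Matrix (Fin m) (Fin n) ℝ) (hr : A.rank ≤ r) (hA : ∀ i j, |A i j| ≤ b) :
    ∃ (u : Fin r → Fin m → ℝ) (v : Fin r → Fin n → ℝ), (∀ k i, |u k i| ≤ 1) ∧
      (∀ k j, |v k j| ≤ b) ∧ ∀ i j, A i j = ∑ k, u k i * v k j := by
  let W := Submodule.span ℝ (Set.range A.row)
  have hW : Module.finrank ℝ W ≤ r := by rwa [← Matrix.rank_eq_finrank_span_row]
  let a : Fin m → W := fun i => ⟨A.row i, Submodule.subset_span (Set.mem_range_self i)⟩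
  have ha : Submodule.span ℝ (Set.range a) = ⊤ := by
    have h1 := Submodule.span_span_coe_preimage (R := ℝ) (s := Set.range A.row)
    rw [← h1]
    congr 1
    ext x
    constructor
    · rintro ⟨i, rfl⟩; exact ⟨i, rfl⟩
    · rintro ⟨i, hi⟩; exact ⟨i, Subtype.ext hi⟩
  obtain ⟨σ, c, hc, hac⟩ := exists_bounded_coordinates a ha
  have hA' : ∀ i j, A i j = ∑ k, c i k * A (σ k) j := by
    intro i j
    have := congrArg (fun w : W => (w : Fin n → ℝ) j) (hac i)
    simpa [a, Finset.sum_apply] using this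
  -- pad with zeros up to `r` summands
  refine ⟨fun k i => if h : (k : ℕ) < Module.finrank ℝ W then c i ⟨k, h⟩ else 0,
    fun k j => if h : (k : ℕ) < Module.finrank ℝ W then A (σ ⟨k, h⟩) j else 0, ?_, ?_, ?_⟩
  · intro k i
    dsimp only
    split_ifs
    · exact hc _ _
    · simp
  · intro k j
    dsimp only
    split_ifs
    · exact hA _ _
    · simpa using hb
  · intro i j
    rw [hA' i j]
    refine Finset.sum_of_injOn (Fin.castLE hW) (Fin.castLE_injective hW).injOn (by simp) ?_ ?_
    · intro k _ hk
      have : ¬ (k : ℕ) < Module.finrank ℝ W := fun h =>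
        hk ⟨⟨k, h⟩, by simp, by ext; simp⟩
      simp [this]
    · intro k _
      simp

/-- The sign `±1` encoded by a Boolean. -/
def sgn (b : Bool) : ℝ := if b then 1 else -1

theorem exists_sgn_mul_eq_abs (x : ℝ) : ∃ s, sgn s * x = |x| := by
  rcases abs_choice x with h | h
  · exact ⟨true, by simp [sgn, h]⟩
  · exact ⟨false, by simp [sgn, h]⟩

theorem abs_sgn (s : Bool) : |sgn s| = 1 := by cases s <;> simp [sgn]

/-- A bilinear form on a product of two boxes is at most its value at a pair of vertices. -/
theorem exists_sgn_bilinear_ge {ι κ : Type*} [Fintype ι] [Fintype κ] (g : ι → κ → ℝ) {b : ℝ}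
    (u : ι → ℝ) (v : κ → ℝ) (hu : ∀ i, |u i| ≤ 1) (hv : ∀ j, |v j| ≤ b) :
    ∃ (s : ι → Bool) (s' : κ → Bool),
      ∑ i, ∑ j, g i j * (u i * v j) ≤ b * ∑ i, ∑ j, g i j * (sgn (s i) * sgn (s' j)) := by
  choose s hs using fun i => exists_sgn_mul_eq_abs (∑ j, g i j * v j)
  choose s' hs' using fun j => exists_sgn_mul_eq_abs (∑ i, g i j * sgn (s i))
  refine ⟨s, s', ?_⟩
  calc ∑ i, ∑ j, g i j * (u i * v j) = ∑ i, u i * ∑ j, g i j * v j := by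
        simp_rw [Finset.mul_sum]
        exact Finset.sum_congr rfl fun i _ => Finset.sum_congr rfl fun j _ => by ring
    _ ≤ ∑ i, sgn (s i) * ∑ j, g i j * v j := by
        refine Finset.sum_le_sum fun i _ => ?_
        rw [hs i]
        refine (le_abs_self _).trans ?_
        rw [abs_mul]
        exact mul_le_of_le_one_left (abs_nonneg _) (hu i)
    _ = ∑ j, v j * ∑ i, g i j * sgn (s i) := by
        simp_rw [Finset.mul_sum]
        rw [Finset.sum_comm]
        exact Finset.sum_congr rfl fun i _ => Finset.sum_congr rfl fun j _ => by ring
    _ ≤ ∑ j, b * (sgn (s' j) * ∑ i, g i j * sgn (s i)) := by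
        refine Finset.sum_le_sum fun j _ => ?_
        rw [hs' j]
        refine (le_abs_self _).trans ?_
        rw [abs_mul]
        exact mul_le_mul_of_nonneg_right (hv j) (abs_nonneg _)
    _ = b * ∑ i, ∑ j, g i j * (sgn (s i) * sgn (s' j)) := by
        simp_rw [← Finset.mul_sum]
        congr 1
        simp_rw [Finset.mul_sum]
        rw [Finset.sum_comm]
        exact Finset.sum_congr rfl fun i _ => Finset.sum_congr rfl fun j _ => by ring

/-- A linear functional of a matrix of rank at most `r` with entries at most `b` is at most `r * b`
times its value at a rank-one sign matrix. This replaces the supremum over an infinite class by a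
maximum over `2 ^ (m + n)` points. -/
theorem exists_sgn_ge_of_rank_le {m n r : ℕ} (g : Fin m → Fin n → ℝ) {b : ℝ} (hb : 0 ≤ b)
    (hr0 : 0 < r) (A : Matrix (Fin m) (Fin n) ℝ) (hr : A.rank ≤ r) (hA : ∀ i j, |A i j| ≤ b) :
    ∃ (s : Fin m → Bool) (s' : Fin n → Bool),
      ∑ i, ∑ j, g i j * A i j ≤ r * b * ∑ i, ∑ j, g i j * (sgn (s i) * sgn (s' j)) := by
  obtain ⟨u, v, hu, hv, huv⟩ := exists_bounded_factorization hb A hr hA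
  have h1 : ∑ i, ∑ j, g i j * A i j = ∑ k, ∑ i, ∑ j, g i j * (u k i * v k j) := by
    simp_rw [huv, Finset.mul_sum]
    exact (Finset.sum_congr rfl fun i _ => Finset.sum_comm).trans Finset.sum_comm
  have : Nonempty (Fin r) := ⟨⟨0, hr0⟩⟩
  obtain ⟨k, hk⟩ := Finite.exists_max fun k => ∑ i, ∑ j, g i j * (u k i * v k j)
  obtain ⟨s, s', hs⟩ := exists_sgn_bilinear_ge g (u k) (v k) (hu k) (hv k)
  refine ⟨s, s', ?_⟩
  rw [h1, mul_assoc]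
  calc _ ≤ ∑ _k : Fin r, _ := Finset.sum_le_sum fun k' _ => (hk k').trans hs
    _ = _ := by simp

/-! ### Exponential moments of suprema over low-rank matrices -/

/-- The uniform law on the two signs. -/
def signLaw : Measure Bool := (2⁻¹ : ℝ≥0∞) • (Measure.dirac true + Measure.dirac false)

instance : IsProbabilityMeasure signLaw where
  measure_univ := by
    simp only [signLaw, Measure.smul_apply, Measure.add_apply, measure_univ, smul_eq_mul]
    rw [one_add_one_eq_two]
    exact ENNReal.inv_mul_cancel (by simp) (by simp)

theorem lintegral_signLaw (F : Bool → ℝ≥0∞) :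
    ∫⁻ b, F b ∂signLaw = 2⁻¹ * (F true + F false) := by
  simp [signLaw, lintegral_add_measure, mul_add]

theorem lintegral_prod_prod_signLaw {X : Type*} [MeasurableSpace X] (ν : Measure X)
    [IsProbabilityMeasure ν] (F : X → X → Bool → ℝ≥0∞)
    (hF : Measurable fun z : X × X × Bool => F z.1 z.2.1 z.2.2) :
    ∫⁻ z, F z.1 z.2.1 z.2.2 ∂(ν.prod (ν.prod signLaw)) =
      ∫⁻ x, ∫⁻ y, 2⁻¹ * (F x y true + F x y false) ∂ν ∂ν := by
  rw [lintegral_prod _ hF.aemeasurable]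
  refine lintegral_congr fun x => ?_
  have h := lintegral_prod (μ := ν) (ν := signLaw) (fun z : X × Bool => F x z.1 z.2)
    (hF.comp measurable_prodMk_left).aemeasurable
  exact h.trans (lintegral_congr fun y => lintegral_signLaw _)

section ExponentialMoments

variable {X T : Type*} [MeasurableSpace X] [Finite T]

/-- Jensen's inequality for the exponential, without integrability of the exponential. -/
theorem ofReal_exp_integral_le (ν : Measure X) [IsProbabilityMeasure ν] {g : X → ℝ}
    (hg : Integrable g ν) :
    ENNReal.ofReal (Real.exp (∫ x, g x ∂ν)) ≤ ∫⁻ x, ENNReal.ofReal (Real.exp (g x)) ∂ν := by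
  by_cases hfin : ∫⁻ x, ENNReal.ofReal (Real.exp (g x)) ∂ν = ⊤
  · rw [hfin]; exact le_top
  have hint : Integrable (fun x => Real.exp (g x)) ν := by
    refine ⟨Real.continuous_exp.comp_aestronglyMeasurable hg.1, ?_⟩
    rw [hasFiniteIntegral_iff_ofReal (Filter.Eventually.of_forall fun x => (Real.exp_pos _).le)]
    exact lt_top_iff_ne_top.2 hfin
  rw [← ofReal_integral_eq_lintegral_ofReal hint
    (Filter.Eventually.of_forall fun x => (Real.exp_pos _).le)]
  exact ENNReal.ofReal_le_ofReal (convexOn_exp.map_integral_le Real.continuous_exp.continuousOn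
    isClosed_univ (Filter.Eventually.of_forall fun _ => Set.mem_univ _) hg hint)

/-- Symmetrization and contraction for one random variable, with the contribution `h` of the
others frozen: a centred random function that is Lipschitz in `d t` with random constant `a` is
replaced by a random sign times `d t`, the constant being that of two independent copies. -/
theorem lintegral_exp_iSup_symmetrize [Nonempty T] (ν : Measure X)
    [IsProbabilityMeasure ν] (h d : T → ℝ)
    (f : X → T → ℝ) (a : X → ℝ) (hf : ∀ t, Measurable fun x => f x t) (ha : Measurable a)
    (hint : ∀ t, Integrable (fun x => f x t) ν)
    (hbd : ∀ᵐ x ∂ν, 0 ≤ a x ∧ (∀ t, |f x t| ≤ a x * |d t|) ∧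
      ∀ t t', |f x t - f x t'| ≤ a x * |d t - d t'|) :
    ∫⁻ x, ENNReal.ofReal (Real.exp (⨆ t, (h t + (f x t - ∫ y, f y t ∂ν)))) ∂ν ≤
      ∫⁻ z, ENNReal.ofReal (Real.exp (⨆ t, (h t + sgn z.2.2 * (a z.1 + a z.2.1) * d t)))
        ∂(ν.prod (ν.prod signLaw)) := by
  set Φ : X → X → ℝ≥0∞ := fun x y =>
    ENNReal.ofReal (Real.exp (⨆ t, (h t + (f x t - f y t)))) with hΦ
  set Ψ : X → X → Bool → ℝ≥0∞ := fun x y s =>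
    ENNReal.ofReal (Real.exp (⨆ t, (h t + sgn s * (a x + a y) * d t))) with hΨ
  have hΦm : Measurable (Function.uncurry Φ) := by
    refine ENNReal.measurable_ofReal.comp (Real.measurable_exp.comp (Measurable.iSup fun t => ?_))
    exact measurable_const.add (((hf t).comp measurable_fst).sub ((hf t).comp measurable_snd))
  have hsgn : Measurable sgn := measurable_of_finite _
  have hΨm : Measurable (fun z : X × X × Bool => Ψ z.1 z.2.1 z.2.2) := by
    refine ENNReal.measurable_ofReal.comp (Real.measurable_exp.comp (Measurable.iSup fun t => ?_))
    fun_prop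
  -- Jensen's inequality replaces the mean by an independent copy, whose exchange with the
  -- original supplies the sign
  have h1 : ∫⁻ x, ENNReal.ofReal (Real.exp (⨆ t, (h t + (f x t - ∫ y, f y t ∂ν)))) ∂ν ≤
      ∫⁻ x, ∫⁻ y, Φ x y ∂ν ∂ν := by
    refine lintegral_mono fun x => ?_
    obtain ⟨t, ht⟩ := exists_eq_ciSup_of_finite (f := fun t => h t + (f x t - ∫ y, f y t ∂ν))
    rw [← ht]
    have : h t + (f x t - ∫ y, f y t ∂ν) = ∫ y, (h t + (f x t - f y t)) ∂ν := by
      have hi : Integrable (fun y => f x t - f y t) ν := (integrable_const _).sub (hint t)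
      rw [integral_add (integrable_const _) hi, integral_sub (integrable_const _) (hint t)]
      simp
    rw [this]
    refine (ofReal_exp_integral_le ν
      ((integrable_const _).add ((integrable_const _).sub (hint t)))).trans ?_
    refine lintegral_mono fun y => ENNReal.ofReal_le_ofReal (Real.exp_le_exp.2 ?_)
    exact le_ciSup (f := fun t => h t + (f x t - f y t)) (Set.finite_range _).bddAbove t
  have h2 : ∫⁻ x, ∫⁻ y, Φ x y ∂ν ∂ν = 2⁻¹ * ∫⁻ x, ∫⁻ y, (Φ x y + Φ y x) ∂ν ∂ν := by
    have hsw : ∫⁻ x, ∫⁻ y, Φ y x ∂ν ∂ν = ∫⁻ x, ∫⁻ y, Φ x y ∂ν ∂ν :=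
      (lintegral_lintegral_swap hΦm.aemeasurable).symm
    have : ∫⁻ x, ∫⁻ y, (Φ x y + Φ y x) ∂ν ∂ν = 2 * ∫⁻ x, ∫⁻ y, Φ x y ∂ν ∂ν := by
      have hin : ∀ x, ∫⁻ y, (Φ x y + Φ y x) ∂ν = ∫⁻ y, Φ x y ∂ν + ∫⁻ y, Φ y x ∂ν := fun x =>
        lintegral_add_left (hΦm.comp measurable_prodMk_left) _
      simp_rw [hin]
      have hm : Measurable fun x => ∫⁻ y, Φ x y ∂ν := hΦm.lintegral_prod_right'
      rw [lintegral_add_left hm, hsw, two_mul]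
    rw [this, ← mul_assoc, ENNReal.inv_mul_cancel (by simp) (by simp), one_mul]
  have h3 : ∫⁻ z, Ψ z.1 z.2.1 z.2.2 ∂(ν.prod (ν.prod signLaw)) =
      2⁻¹ * ∫⁻ x, ∫⁻ y, (Ψ x y true + Ψ x y false) ∂ν ∂ν := by
    rw [lintegral_prod_prod_signLaw ν Ψ hΨm, ← lintegral_const_mul' _ _ (by simp)]
    exact lintegral_congr fun x => lintegral_const_mul' _ _ (by simp)
  refine h1.trans ?_
  rw [h2]
  refine le_trans ?_ h3.ge
  refine mul_le_mul_right ?_ _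
  refine lintegral_mono_ae ?_
  filter_upwards [hbd] with x hx
  refine lintegral_mono_ae ?_
  filter_upwards [hbd] with y hy
  obtain ⟨hx0, hx1, hx2⟩ := hx
  obtain ⟨hy0, hy1, hy2⟩ := hy
  have hc := exp_iSup_contraction h (fun t => f x t - f y t) (fun t => (a x + a y) * d t)
    (fun t => by
      rw [abs_mul, abs_of_nonneg (add_nonneg hx0 hy0), add_mul]
      exact (abs_sub _ _).trans (add_le_add (hx1 t) (hy1 t)))
    (fun t t' => by
      rw [← mul_sub, abs_mul, abs_of_nonneg (add_nonneg hx0 hy0), add_mul]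
      refine le_trans ?_ (add_le_add (hx2 t t') (hy2 t t'))
      have : f x t - f y t - (f x t' - f y t') = (f x t - f x t') - (f y t - f y t') := by ring
      rw [this]
      exact abs_sub _ _)
  have e1 : ∀ t, h t - (f x t - f y t) = h t + (f y t - f x t) := fun t => by ring
  have e2 : ∀ t, h t + sgn true * (a x + a y) * d t = h t + (a x + a y) * d t := fun t => by
    simp [sgn]
  have e3 : ∀ t, h t + sgn false * (a x + a y) * d t = h t - (a x + a y) * d t := fun t => by
    simp [sgn]; ring
  simp only [hΦ, hΨ, e2, e3]
  simp only [e1] at hc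
  rw [← ENNReal.ofReal_add (Real.exp_pos _).le (Real.exp_pos _).le,
    ← ENNReal.ofReal_add (Real.exp_pos _).le (Real.exp_pos _).le]
  exact ENNReal.ofReal_le_ofReal hc

/-- Comparison of exponential moments of suprema passes from single coordinates, with an arbitrary
frozen offset `h`, to sums over independent coordinates. -/
theorem lintegral_exp_iSup_sum_le {I Z : Type*} [Fintype I] [MeasurableSpace Z]
    (κ : I → Measure Z) [∀ p, IsProbabilityMeasure (κ p)] (F G : I → Z → T → ℝ)
    (hF : ∀ p t, Measurable fun z => F p z t) (hG : ∀ p t, Measurable fun z => G p z t)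
    (hFG : ∀ p (h : T → ℝ), ∫⁻ z, ENNReal.ofReal (Real.exp (⨆ t, (h t + F p z t))) ∂κ p ≤
      ∫⁻ z, ENNReal.ofReal (Real.exp (⨆ t, (h t + G p z t))) ∂κ p) :
    ∫⁻ z, ENNReal.ofReal (Real.exp (⨆ t, ∑ p, F p (z p) t)) ∂Measure.pi κ ≤
      ∫⁻ z, ENNReal.ofReal (Real.exp (⨆ t, ∑ p, G p (z p) t)) ∂Measure.pi κ := by
  classical
  -- the coordinates in `S` are the ones already replaced
  let K : Finset I → I → Z → T → ℝ := fun S p => if p ∈ S then G p else F p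
  have hK : ∀ S p t, Measurable fun z => K S p z t := by
    intro S p t
    by_cases hp : p ∈ S <;> simp only [K, hp, if_true, if_false]
    exacts [hG p t, hF p t]
  let Ψ : Finset I → (I → Z) → ℝ≥0∞ := fun S z =>
    ENNReal.ofReal (Real.exp (⨆ t, ∑ p, K S p (z p) t))
  have hΨ : ∀ S, Measurable (Ψ S) := by
    intro S
    refine ENNReal.measurable_ofReal.comp (Real.measurable_exp.comp (Measurable.iSup fun t => ?_))
    exact Finset.measurable_sum _ fun p _ => (hK S p t).comp (measurable_pi_apply p)
  have key : ∀ S : Finset I, ∫⁻ z, Ψ ∅ z ∂Measure.pi κ ≤ ∫⁻ z, Ψ S z ∂Measure.pi κ := by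
    intro S
    induction S using Finset.induction_on with
    | empty => exact le_rfl
    | insert q S hq ih =>
      refine ih.trans (lintegral_le_of_lmarginal_le {q} (hΨ S) (hΨ _) ?_)
      rw [lmarginal_singleton, lmarginal_singleton]
      intro x
      have hsplit : ∀ (S' : Finset I) (y : Z) (t : T),
          ∑ p, K S' p (Function.update x q y p) t =
            ∑ p ∈ Finset.univ.erase q, K S' p (x p) t + K S' q y t := by
        intro S' y t
        rw [← Finset.sum_erase_add _ _ (Finset.mem_univ q), Function.update_self]
        congr 1
        refine Finset.sum_congr rfl fun p hp => ?_
        rw [Function.update_of_ne (Finset.ne_of_mem_erase hp)]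
      have hsame : ∀ t, ∑ p ∈ Finset.univ.erase q, K (insert q S) p (x p) t =
          ∑ p ∈ Finset.univ.erase q, K S p (x p) t := by
        intro t
        refine Finset.sum_congr rfl fun p hp => ?_
        have : p ∈ insert q S ↔ p ∈ S := by simp [Finset.ne_of_mem_erase hp]
        simp only [K, this]
      have hq1 : K S q = F q := by simp [K, hq]
      have hq2 : K (insert q S) q = G q := by simp [K]
      simp only [Ψ, hsplit, hsame, hq1, hq2]
      exact hFG q _
  simpa [Ψ, K] using key Finset.univ

/-- Exponential moment of a symmetrized bounded variable, in terms of its second moment. The bound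
`exp u ≤ 1 + u + u ^ 2` is available because `|u| ≤ 1` by `hρ`. -/
theorem lintegral_exp_sgn_le (ν : Measure X) [IsProbabilityMeasure ν] (a : X → ℝ)
    (ha : Measurable a) {A κ ρ : ℝ} (hA : ∀ᵐ x ∂ν, 0 ≤ a x ∧ a x ≤ A)
    (hκ : ∫⁻ x, ENNReal.ofReal (a x ^ 2) ∂ν ≤ ENNReal.ofReal (κ ^ 2))
    (hρ : |ρ| * (2 * A) ≤ 1) :
    ∫⁻ z, ENNReal.ofReal (Real.exp (ρ * (sgn z.2.2 * (a z.1 + a z.2.1))))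
      ∂(ν.prod (ν.prod signLaw)) ≤ ENNReal.ofReal (Real.exp (4 * ρ ^ 2 * κ ^ 2)) := by
  have hsgn : Measurable sgn := measurable_of_finite _
  have hm : Measurable (fun z : X × X × Bool =>
      ENNReal.ofReal (Real.exp (ρ * (sgn z.2.2 * (a z.1 + a z.2.1))))) := by fun_prop
  have hsq : ∀ x y, ENNReal.ofReal (1 + 2 * ρ ^ 2 * (a x ^ 2 + a y ^ 2)) =
      1 + ENNReal.ofReal (2 * ρ ^ 2) * (ENNReal.ofReal (a x ^ 2) + ENNReal.ofReal (a y ^ 2)) := by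
    intro x y
    rw [ENNReal.ofReal_add (by norm_num) (by positivity), ENNReal.ofReal_mul (by positivity),
      ENNReal.ofReal_add (by positivity) (by positivity), ENNReal.ofReal_one]
  calc _ = ∫⁻ x, ∫⁻ y, 2⁻¹ * (ENNReal.ofReal (Real.exp (ρ * (sgn true * (a x + a y)))) +
          ENNReal.ofReal (Real.exp (ρ * (sgn false * (a x + a y))))) ∂ν ∂ν := by
        exact lintegral_prod_prod_signLaw ν
          (fun x y s => ENNReal.ofReal (Real.exp (ρ * (sgn s * (a x + a y))))) hm
    _ ≤ ∫⁻ x, ∫⁻ y, ENNReal.ofReal (1 + 2 * ρ ^ 2 * (a x ^ 2 + a y ^ 2)) ∂ν ∂ν := by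
        refine lintegral_mono_ae ?_
        filter_upwards [hA] with x hx
        refine lintegral_mono_ae ?_
        filter_upwards [hA] with y hy
        set c := ρ * (a x + a y) with hc
        have hc1 : |c| ≤ 1 := by
          rw [hc, abs_mul, abs_of_nonneg (add_nonneg hx.1 hy.1)]
          refine le_trans (mul_le_mul_of_nonneg_left ?_ (abs_nonneg _)) hρ
          linarith [hx.2, hy.2]
        have e1 := (abs_le.1 (Real.abs_exp_sub_one_sub_id_le hc1)).2
        have e2 := (abs_le.1 (Real.abs_exp_sub_one_sub_id_le (x := -c) (by rwa [abs_neg]))).2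
        have e3 : ρ * (sgn true * (a x + a y)) = c := by simp [sgn, hc]
        have e4 : ρ * (sgn false * (a x + a y)) = -c := by simp [sgn, hc]; ring
        rw [e3, e4, ← ENNReal.ofReal_add (Real.exp_pos _).le (Real.exp_pos _).le,
          ← ENNReal.ofReal_ofNat 2, ← ENNReal.ofReal_inv_of_pos (by norm_num),
          ← ENNReal.ofReal_mul (by norm_num)]
        refine ENNReal.ofReal_le_ofReal ?_
        have e5 : c ^ 2 ≤ 2 * ρ ^ 2 * (a x ^ 2 + a y ^ 2) := by
          rw [hc]; nlinarith [mul_nonneg (sq_nonneg ρ) (sq_nonneg (a x - a y))]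
        linarith
    _ = 1 + ENNReal.ofReal (2 * ρ ^ 2) * (∫⁻ x, ENNReal.ofReal (a x ^ 2) ∂ν +
          ∫⁻ x, ENNReal.ofReal (a x ^ 2) ∂ν) := by
        have hm2 : Measurable fun x => ENNReal.ofReal (a x ^ 2) := by fun_prop
        simp_rw [hsq]
        have : ∀ x, ∫⁻ y, (1 + ENNReal.ofReal (2 * ρ ^ 2) *
            (ENNReal.ofReal (a x ^ 2) + ENNReal.ofReal (a y ^ 2))) ∂ν =
            1 + ENNReal.ofReal (2 * ρ ^ 2) * (ENNReal.ofReal (a x ^ 2) +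
              ∫⁻ y, ENNReal.ofReal (a y ^ 2) ∂ν) := by
          intro x
          rw [lintegral_add_left measurable_const, lintegral_const_mul _ (by fun_prop),
            lintegral_add_left measurable_const]
          simp
        simp_rw [this]
        rw [lintegral_add_left measurable_const, lintegral_const_mul _ (by fun_prop),
            lintegral_add_right _ measurable_const]
        simp
    _ ≤ 1 + ENNReal.ofReal (2 * ρ ^ 2) * (ENNReal.ofReal (κ ^ 2) + ENNReal.ofReal (κ ^ 2)) := by
        gcongr
    _ = ENNReal.ofReal (1 + 4 * ρ ^ 2 * κ ^ 2) := by
        rw [← ENNReal.ofReal_add (by positivity) (by positivity),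
          ← ENNReal.ofReal_mul (by positivity), ← ENNReal.ofReal_one,
          ← ENNReal.ofReal_add (by norm_num) (by positivity)]
        congr 1; ring
    _ ≤ _ := by
        refine ENNReal.ofReal_le_ofReal ?_
        linarith [Real.add_one_le_exp (4 * ρ ^ 2 * κ ^ 2)]

theorem lintegral_pi_prod {I Z : Type*} [Fintype I] [MeasurableSpace Z]
    (κ : I → Measure Z) [∀ p, IsProbabilityMeasure (κ p)] (E : I → Z → ℝ≥0∞)
    (hE : ∀ p, Measurable (E p)) :
    ∫⁻ z, ∏ p, E p (z p) ∂Measure.pi κ = ∏ p, ∫⁻ z, E p z ∂κ p := by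
  have h := lintegral_prod_eq_prod_lintegral_of_indepFun (μ := Measure.pi κ) Finset.univ
    (fun p z => E p (z p)) (iIndepFun_pi fun p => (hE p).aemeasurable)
    (fun p => (hE p).comp (measurable_pi_apply p))
  refine h.trans (Finset.prod_congr rfl fun p _ => ?_)
  rw [← lintegral_map (hE p) (measurable_pi_apply p), (measurePreserving_eval κ p).map_eq]

/-- The maximum over sign pairs is bounded by the sum over them, which factorizes over the
entries. -/
theorem exp_iSup_linear_le [Nonempty T] {m n r : ℕ} (hr0 : 0 < r) {b : ℝ}
    (hb : 0 ≤ b) (D : T → Matrix (Fin m) (Fin n) ℝ) (hrank : ∀ t, (D t).rank ≤ r)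
    (hD : ∀ t i j, |D t i j| ≤ b) (g : Fin m × Fin n → ℝ) :
    ENNReal.ofReal (Real.exp (⨆ t, ∑ p : Fin m × Fin n, g p * D t p.1 p.2)) ≤
      ∑ s : (Fin m → Bool) × (Fin n → Bool), ∏ p : Fin m × Fin n,
        ENNReal.ofReal (Real.exp ((r * b * (sgn (s.1 p.1) * sgn (s.2 p.2))) * g p)) := by
  obtain ⟨t, ht⟩ := exists_eq_ciSup_of_finite
    (f := fun t => ∑ p : Fin m × Fin n, g p * D t p.1 p.2)
  obtain ⟨s, s', hs⟩ := exists_sgn_ge_of_rank_le (fun i j => g (i, j)) hb hr0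
    (D t) (hrank t) (hD t)
  refine le_trans ?_ (Finset.single_le_sum (fun _ _ => zero_le) (Finset.mem_univ (s, s')))
  rw [← ENNReal.ofReal_prod_of_nonneg (fun _ _ => (Real.exp_pos _).le), ← Real.exp_sum]
  refine ENNReal.ofReal_le_ofReal (Real.exp_le_exp.2 ?_)
  rw [← ht, Fintype.sum_prod_type, Fintype.sum_prod_type]
  refine hs.trans (le_of_eq ?_)
  simp_rw [Finset.mul_sum]
  exact Finset.sum_congr rfl fun i _ => Finset.sum_congr rfl fun j _ => by ring

/-- Exponential moment of the supremum of a linear process with independent symmetrized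
coefficients over matrices of rank at most `r` with entries at most `b`: the supremum is at most
`r * b` times the value at one of `2 ^ (m + n)` pairs of sign vectors. -/
theorem lintegral_exp_iSup_linear_le [Nonempty T] {m n r : ℕ} (hr0 : 0 < r) {b A κ : ℝ}
    (hb : 0 ≤ b) (ν : Fin m × Fin n → Measure X) [∀ p, IsProbabilityMeasure (ν p)]
    (D : T → Matrix (Fin m) (Fin n) ℝ) (hrank : ∀ t, (D t).rank ≤ r)
    (hD : ∀ t i j, |D t i j| ≤ b) (a : Fin m × Fin n → X → ℝ) (ha : ∀ p, Measurable (a p))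
    (hbd : ∀ p, ∀ᵐ x ∂ν p, 0 ≤ a p x ∧ a p x ≤ A)
    (hκ : ∀ p, ∫⁻ x, ENNReal.ofReal (a p x ^ 2) ∂ν p ≤ ENNReal.ofReal (κ ^ 2))
    (hA : r * b * (2 * A) ≤ 1) :
    ∫⁻ z, ENNReal.ofReal (Real.exp (⨆ t, ∑ p : Fin m × Fin n,
        sgn (z p).2.2 * (a p (z p).1 + a p (z p).2.1) * D t p.1 p.2))
      ∂Measure.pi (fun p => (ν p).prod ((ν p).prod signLaw)) ≤
      ENNReal.ofReal (2 ^ (m + n) * Real.exp (4 * (r * b) ^ 2 * κ ^ 2 * (m * n))) := by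
  have hsgn : Measurable sgn := measurable_of_finite _
  have hE : ∀ (s : (Fin m → Bool) × (Fin n → Bool)) (p : Fin m × Fin n),
      Measurable fun z : X × X × Bool => ENNReal.ofReal (Real.exp
        ((r * b * (sgn (s.1 p.1) * sgn (s.2 p.2))) * (sgn z.2.2 * (a p z.1 + a p z.2.1)))) := by
    intro s p
    have := ha p
    fun_prop
  refine (lintegral_mono fun z => exp_iSup_linear_le hr0 hb D hrank hD _).trans ?_
  have hprod : ∀ s : (Fin m → Bool) × (Fin n → Bool),
      Measurable fun z : Fin m × Fin n → X × X × Bool => ∏ p : Fin m × Fin n,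
        ENNReal.ofReal (Real.exp ((r * b * (sgn (s.1 p.1) * sgn (s.2 p.2))) *
          (sgn (z p).2.2 * (a p (z p).1 + a p (z p).2.1)))) := fun s =>
    Finset.measurable_prod _ fun p _ => (hE s p).comp (measurable_pi_apply p)
  rw [lintegral_finsetSum _ fun s _ => hprod s]
  calc _ = ∑ s : (Fin m → Bool) × (Fin n → Bool), ∏ p : Fin m × Fin n,
        ∫⁻ z, ENNReal.ofReal (Real.exp ((r * b * (sgn (s.1 p.1) * sgn (s.2 p.2))) *
          (sgn z.2.2 * (a p z.1 + a p z.2.1)))) ∂((ν p).prod ((ν p).prod signLaw)) :=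
        Finset.sum_congr rfl fun s _ =>
          lintegral_pi_prod (fun p => (ν p).prod ((ν p).prod signLaw)) _ (hE s)
    _ ≤ ∑ _s : (Fin m → Bool) × (Fin n → Bool), ∏ _p : Fin m × Fin n,
          ENNReal.ofReal (Real.exp (4 * (r * b) ^ 2 * κ ^ 2)) := by
        refine Finset.sum_le_sum fun s _ => Finset.prod_le_prod' fun p _ => ?_
        have habs : |(r * b * (sgn (s.1 p.1) * sgn (s.2 p.2)) : ℝ)| = r * b := by
          rw [abs_mul, abs_mul (sgn _), abs_sgn, abs_sgn, abs_of_nonneg (by positivity)]; ring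
        have := lintegral_exp_sgn_le (ν p) (a p) (ha p) (A := A) (κ := κ)
          (ρ := r * b * (sgn (s.1 p.1) * sgn (s.2 p.2)))
          (hbd p) (hκ p) (by rwa [habs])
        rw [← sq_abs (r * b * _ : ℝ), habs] at this
        exact this
    _ = _ := by
        rw [Finset.sum_const, Finset.prod_const, nsmul_eq_mul, ← ENNReal.ofReal_pow
          (Real.exp_pos _).le, ← Real.exp_nat_mul, ENNReal.ofReal_mul (by positivity)]
        congr 1
        · simp [pow_add, ENNReal.ofReal_mul, ENNReal.ofReal_pow]
        · congr 2
          simp; ring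

/-- Exponential moment of the supremum of a centred process that is indexed by finitely many
matrices of rank at most `r` with entries at most `b`. After symmetrization and contraction the
process is linear, and the supremum is attained at one of `2 ^ (m + n)` pairs of sign vectors. -/
theorem lintegral_exp_iSup_process_le [Nonempty T] {m n r : ℕ} (hr0 : 0 < r) {b A κ : ℝ}
    (hb : 0 ≤ b)
    (ν : Fin m × Fin n → Measure X) [∀ p, IsProbabilityMeasure (ν p)]
    (D : T → Matrix (Fin m) (Fin n) ℝ) (hrank : ∀ t, (D t).rank ≤ r)
    (hD : ∀ t i j, |D t i j| ≤ b)
    (f : Fin m × Fin n → X → T → ℝ) (a : Fin m × Fin n → X → ℝ)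
    (hf : ∀ p t, Measurable fun x => f p x t) (ha : ∀ p, Measurable (a p))
    (hbd : ∀ p, ∀ᵐ x ∂ν p, 0 ≤ a p x ∧ a p x ≤ A ∧ (∀ t, |f p x t| ≤ a p x * |D t p.1 p.2|) ∧
      ∀ t t', |f p x t - f p x t'| ≤ a p x * |D t p.1 p.2 - D t' p.1 p.2|)
    (hκ : ∀ p, ∫⁻ x, ENNReal.ofReal (a p x ^ 2) ∂ν p ≤ ENNReal.ofReal (κ ^ 2))
    (hA : r * b * (2 * A) ≤ 1) :
    ∫⁻ z, ENNReal.ofReal (Real.exp (⨆ t, ∑ p, (f p (z p) t - ∫ y, f p y t ∂ν p)))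
      ∂Measure.pi ν ≤
      ENNReal.ofReal (2 ^ (m + n) * Real.exp (4 * (r * b) ^ 2 * κ ^ 2 * (m * n))) := by
  have hsgn : Measurable sgn := measurable_of_finite _
  have hint : ∀ p t, Integrable (fun x => f p x t) (ν p) := by
    intro p t
    refine Integrable.of_bound (hf p t).aestronglyMeasurable (A * b) ?_
    filter_upwards [hbd p] with x hx
    rw [Real.norm_eq_abs]
    exact (hx.2.2.1 t).trans (mul_le_mul hx.2.1 (hD t _ _) (abs_nonneg _) (hx.1.trans hx.2.1))
  let κ' : Fin m × Fin n → Measure (X × X × Bool) := fun p => (ν p).prod ((ν p).prod signLaw)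
  have hκ' : (Measure.pi κ').map (fun z p => (z p).1) = Measure.pi ν := by
    rw [Measure.pi_map_pi (fun p => measurable_fst.aemeasurable)]
    congr 1; funext p
    exact Measure.map_fst_prod.trans (by simp)
  have hmeas : Measurable fun z : Fin m × Fin n → X =>
      ENNReal.ofReal (Real.exp (⨆ t, ∑ p, (f p (z p) t - ∫ y, f p y t ∂ν p))) := by
    refine ENNReal.measurable_ofReal.comp (Real.measurable_exp.comp (Measurable.iSup fun t => ?_))
    exact Finset.measurable_sum _ fun p _ =>
      ((hf p t).comp (measurable_pi_apply p)).sub measurable_const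
  rw [← hκ', lintegral_map hmeas (by fun_prop)]
  have hFm : ∀ p t, Measurable fun z : X × X × Bool => f p z.1 t - ∫ y, f p y t ∂ν p :=
    fun p t => ((hf p t).comp measurable_fst).sub measurable_const
  have hGm : ∀ p t, Measurable fun z : X × X × Bool =>
      sgn z.2.2 * (a p z.1 + a p z.2.1) * D t p.1 p.2 := by
    intro p t
    have := ha p
    fun_prop
  refine (lintegral_exp_iSup_sum_le κ' (fun p z t => f p z.1 t - ∫ y, f p y t ∂ν p)
    (fun p z t => sgn z.2.2 * (a p z.1 + a p z.2.1) * D t p.1 p.2) hFm hGm ?_).trans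
    (lintegral_exp_iSup_linear_le hr0 hb ν D hrank hD a ha ?_ hκ hA)
  · intro p h
    refine le_trans (le_of_eq ?_) (lintegral_exp_iSup_symmetrize (ν p) h (fun t => D t p.1 p.2)
      (f p) (a p) (hf p) (ha p) (hint p) ?_)
    · have hm1 : Measurable fun x => ENNReal.ofReal
          (Real.exp (⨆ t, (h t + (f p x t - ∫ y, f p y t ∂ν p)))) := by
        refine ENNReal.measurable_ofReal.comp
          (Real.measurable_exp.comp (Measurable.iSup fun t => ?_))
        exact measurable_const.add ((hf p t).sub measurable_const)
      have : (κ' p).map Prod.fst = ν p := Measure.map_fst_prod.trans (by simp)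
      rw [← lintegral_map (μ := κ' p) hm1 measurable_fst, this]
    · filter_upwards [hbd p] with x hx using ⟨hx.1, hx.2.2⟩
  · intro p
    filter_upwards [hbd p] with x hx using ⟨hx.1, hx.2.1⟩

end ExponentialMoments

/-! ### Tail bound for the centred process -/

/-- A set of matrices with bounded entries has a finite entrywise `ε`-net inside itself. -/
theorem exists_finite_entrywise_net {m n : ℕ} (𝒯 : Set (Matrix (Fin m) (Fin n) ℝ)) {b ε : ℝ}
    (hb : ∀ D ∈ 𝒯, ∀ i j, |D i j| ≤ b) (hε : 0 < ε) :
    ∃ F ⊆ 𝒯, F.Finite ∧ ∀ D ∈ 𝒯, ∃ D' ∈ F, ∀ i j, |D i j - D' i j| ≤ ε := by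
  have htb : TotallyBounded (show Set (Fin m → Fin n → ℝ) from 𝒯) := by
    refine TotallyBounded.subset (fun D hD => ?_)
      (isCompact_univ_pi fun _ : Fin m => isCompact_univ_pi fun _ : Fin n =>
        isCompact_Icc (a := -b) (b := b)).totallyBounded
    exact fun i _ j _ => abs_le.1 (hb D hD i j)
  obtain ⟨F, hF, hfin, hcov⟩ := Metric.finite_approx_of_totallyBounded htb ε hε
  refine ⟨F, hF, hfin, fun D hD => ?_⟩
  obtain ⟨D', hD', hlt⟩ := Set.mem_iUnion₂.1 (hcov hD)
  refine ⟨D', hD', fun i j => ?_⟩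
  have h1 : dist (D i j) (D' i j) ≤ dist (α := Fin m → Fin n → ℝ) D D' :=
    (dist_le_pi_dist (D i) (D' i) j).trans
      (dist_le_pi_dist (X := fun _ : Fin m => Fin n → ℝ) D D' i)
  rw [Real.dist_eq] at h1
  exact h1.trans (le_of_lt hlt)

section ProcessTail

variable {Ω X : Type*} [MeasurableSpace Ω] [MeasurableSpace X]

/-- The case of a finite index set in `measure_process_ge_le`, by the exponential Markov
inequality. -/
theorem measure_finite_process_ge_le (μ : Measure Ω) [IsProbabilityMeasure μ] {m n r : ℕ}
    (hr0 : 0 < r) {b A κ c u : ℝ} (hb : 0 ≤ b) (hc : 0 < c)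
    (ξ : Fin m × Fin n → Ω → X) (hξ : ∀ p, Measurable (ξ p)) (hind : iIndepFun ξ μ)
    (f : Fin m × Fin n → X → ℝ → ℝ) (a : Fin m × Fin n → X → ℝ) (S : Fin m × Fin n → Set ℝ)
    (hf : ∀ p s, Measurable fun x => f p x s) (ha : ∀ p, Measurable (a p))
    (hbd : ∀ᵐ ω ∂μ, ∀ p, 0 ≤ a p (ξ p ω) ∧ a p (ξ p ω) ≤ A ∧ ∀ s ∈ S p, ∀ s' ∈ S p,
      |f p (ξ p ω) s - f p (ξ p ω) s'| ≤ a p (ξ p ω) * |s - s'|)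
    (hf0 : ∀ p x, f p x 0 = 0) (hS0 : ∀ p, 0 ∈ S p)
    (hκ : ∀ p, ∫⁻ ω, ENNReal.ofReal (a p (ξ p ω) ^ 2) ∂μ ≤ ENNReal.ofReal (κ ^ 2))
    (hA : c * (r * b * (2 * A)) ≤ 1)
    (F : Set (Matrix (Fin m) (Fin n) ℝ)) (hfin : F.Finite)
    (hF : ∀ D ∈ F, D.rank ≤ r ∧ ∀ i j, |D i j| ≤ b ∧ D i j ∈ S (i, j)) :
    μ {ω | ∃ D ∈ F, u ≤ ∑ p, (f p (ξ p ω) (D p.1 p.2) - ∫ ω', f p (ξ p ω') (D p.1 p.2) ∂μ)} ≤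
      ENNReal.ofReal (2 ^ (m + n) * Real.exp (4 * (c * (r * b)) ^ 2 * κ ^ 2 * (m * n)) *
        Real.exp (-(c * u))) := by
  rcases F.eq_empty_or_nonempty with rfl | hne
  · simp
  have : Finite F := hfin
  have : Nonempty F := hne.to_subtype
  let ν : Fin m × Fin n → Measure X := fun p => μ.map (ξ p)
  have hν : ∀ p, IsProbabilityMeasure (ν p) :=
    fun p => Measure.isProbabilityMeasure_map (hξ p).aemeasurable
  have hlaw : μ.map (fun ω p => ξ p ω) = Measure.pi ν :=
    (iIndepFun_iff_map_fun_eq_pi_map fun p => (hξ p).aemeasurable).1 hind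
  have hint : ∀ p (t : F), ∫ x, c * f p x (t.1 p.1 p.2) ∂ν p =
      c * ∫ ω', f p (ξ p ω') (t.1 p.1 p.2) ∂μ := by
    intro p t
    rw [integral_const_mul, integral_map (hξ p).aemeasurable (hf p _).aestronglyMeasurable]
  have hΦ : Measurable fun z : Fin m × Fin n → X => ENNReal.ofReal (Real.exp (⨆ t : F, ∑ p,
      (c * f p (z p) (t.1 p.1 p.2) - ∫ x, c * f p x (t.1 p.1 p.2) ∂ν p))) := by
    refine ENNReal.measurable_ofReal.comp (Real.measurable_exp.comp (Measurable.iSup fun t => ?_))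
    exact Finset.measurable_sum _ fun p _ =>
      (((hf p _).comp (measurable_pi_apply p)).const_mul c).sub measurable_const
  have hmain := lintegral_exp_iSup_process_le hr0 (b := c * b) (A := A) (κ := κ) (by positivity) ν
    (fun t : F => c • t.1) (fun t => ?_) (fun t i j => ?_)
    (fun p x t => c * f p x (t.1 p.1 p.2)) a (fun p t => (hf p _).const_mul c) ha ?_ ?_
    (by linarith)
  · rw [← hlaw, lintegral_map hΦ (measurable_pi_lambda _ hξ)] at hmain
    have hsub : {ω | ∃ D ∈ F, u ≤
        ∑ p, (f p (ξ p ω) (D p.1 p.2) - ∫ ω', f p (ξ p ω') (D p.1 p.2) ∂μ)} ⊆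
        {ω | ENNReal.ofReal (Real.exp (c * u)) ≤ ENNReal.ofReal (Real.exp (⨆ t : F, ∑ p,
          (c * f p (ξ p ω) (t.1 p.1 p.2) - ∫ x, c * f p x (t.1 p.1 p.2) ∂ν p)))} := by
      rintro ω ⟨D, hD, hu⟩
      refine ENNReal.ofReal_le_ofReal (Real.exp_le_exp.2 ?_)
      refine le_trans ?_ (le_ciSup (f := fun t : F => ∑ p,
          (c * f p (ξ p ω) (t.1 p.1 p.2) - ∫ x, c * f p x (t.1 p.1 p.2) ∂ν p))
          (Set.finite_range _).bddAbove ⟨D, hD⟩)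
      refine (mul_le_mul_of_nonneg_left hu hc.le).trans (le_of_eq ?_)
      rw [Finset.mul_sum]
      exact Finset.sum_congr rfl fun p _ => by rw [hint p ⟨D, hD⟩, mul_sub]
    refine (measure_mono hsub).trans ?_
    have hmk := mul_meas_ge_le_lintegral (μ := μ) (hΦ.comp (measurable_pi_lambda _ hξ))
      (ENNReal.ofReal (Real.exp (c * u)))
    have h2 := hmk.trans hmain
    rw [mul_comm, ← ENNReal.le_div_iff_mul_le (by simp [Real.exp_pos]) (by simp)] at h2
    refine h2.trans (le_of_eq ?_)
    rw [← ENNReal.ofReal_div_of_pos (Real.exp_pos _), Real.exp_neg, div_eq_mul_inv]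
    congr 4
    ring
  · rw [Matrix.rank_smul_of_mem_nonZeroDivisors _ (mem_nonZeroDivisors_of_ne_zero hc.ne')]
    exact (hF _ t.2).1
  · rw [Matrix.smul_apply, smul_eq_mul, abs_mul, abs_of_pos hc]
    exact mul_le_mul_of_nonneg_left ((hF _ t.2).2 i j).1 hc.le
  · intro p
    have key : ∀ᵐ ω ∂μ, 0 ≤ a p (ξ p ω) ∧ a p (ξ p ω) ≤ A ∧
        (∀ t : F, |c * f p (ξ p ω) (t.1 p.1 p.2)| ≤ a p (ξ p ω) * |(c • t.1) p.1 p.2|) ∧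
        ∀ t t' : F, |c * f p (ξ p ω) (t.1 p.1 p.2) - c * f p (ξ p ω) (t'.1 p.1 p.2)| ≤
          a p (ξ p ω) * |(c • t.1) p.1 p.2 - (c • t'.1) p.1 p.2| := by
      filter_upwards [hbd] with ω hω
      obtain ⟨h0, h1, h2⟩ := hω p
      have hmem : ∀ t : F, t.1 p.1 p.2 ∈ S p := fun t => ((hF _ t.2).2 p.1 p.2).2
      refine ⟨h0, h1, fun t => ?_, fun t t' => ?_⟩
      · have := h2 _ (hmem t) 0 (hS0 p)
        rw [hf0, sub_zero, sub_zero] at this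
        rw [Matrix.smul_apply, smul_eq_mul, abs_mul, abs_mul, abs_of_pos hc]
        nlinarith
      · have := h2 _ (hmem t) _ (hmem t')
        rw [Matrix.smul_apply, Matrix.smul_apply, smul_eq_mul, smul_eq_mul, ← mul_sub, ← mul_sub,
          abs_mul, abs_mul, abs_of_pos hc]
        nlinarith
    have tr : ∀ g₁ g₂ : X → ℝ, Measurable g₁ → Measurable g₂ →
        (∀ᵐ ω ∂μ, g₁ (ξ p ω) ≤ g₂ (ξ p ω)) → ∀ᵐ x ∂ν p, g₁ x ≤ g₂ x := fun g₁ g₂ h₁ h₂ h =>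
      (ae_map_iff (hξ p).aemeasurable (measurableSet_le h₁ h₂)).2 h
    have t1 := tr (fun _ => 0) (a p) measurable_const (ha p) (key.mono fun ω h => h.1)
    have t2 := tr (a p) (fun _ => A) (ha p) measurable_const (key.mono fun ω h => h.2.1)
    have t3 := ae_all_iff.2 fun t : F => tr (fun x => |c * f p x (t.1 p.1 p.2)|)
      (fun x => a p x * |(c • t.1) p.1 p.2|)
      (continuous_abs.measurable.comp ((hf p _).const_mul c)) ((ha p).mul_const _)
      (key.mono fun ω h => h.2.2.1 t)
    have t4 := ae_all_iff.2 fun t : F => ae_all_iff.2 fun t' : F =>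
      tr (fun x => |c * f p x (t.1 p.1 p.2) - c * f p x (t'.1 p.1 p.2)|)
        (fun x => a p x * |(c • t.1) p.1 p.2 - (c • t'.1) p.1 p.2|)
        (continuous_abs.measurable.comp (((hf p _).const_mul c).sub ((hf p _).const_mul c)))
        ((ha p).mul_const _) (key.mono fun ω h => h.2.2.2 t t')
    filter_upwards [t1, t2, t3, t4] with x h1 h2 h3 h4 using ⟨h1, h2, h3, h4⟩
  · intro p
    have hm : Measurable fun x => ENNReal.ofReal (a p x ^ 2) :=
      ENNReal.measurable_ofReal.comp ((ha p).pow_const 2)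
    rw [lintegral_map hm (hξ p)]
    exact hκ p

/-- Tail bound for the supremum of a centred process `∑ p, f p (ξ p) (D p)` with independent `ξ p`
over all matrices `D` in `𝒯`. The increments are controlled by random Lipschitz constants with
bound `A` and second moment `κ ^ 2`; the bound `A` makes a finite net exact up to `u / 2`. -/
theorem measure_process_ge_le (μ : Measure Ω) [IsProbabilityMeasure μ] {m n r : ℕ}
    (hr0 : 0 < r) {b A κ c u : ℝ} (hb : 0 ≤ b) (hA0 : 0 ≤ A) (hc : 0 < c) (hu : 0 < u)
    (ξ : Fin m × Fin n → Ω → X) (hξ : ∀ p, Measurable (ξ p)) (hind : iIndepFun ξ μ)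
    (f : Fin m × Fin n → X → ℝ → ℝ) (a : Fin m × Fin n → X → ℝ) (S : Fin m × Fin n → Set ℝ)
    (hf : ∀ p s, Measurable fun x => f p x s) (ha : ∀ p, Measurable (a p))
    (hbd : ∀ᵐ ω ∂μ, ∀ p, 0 ≤ a p (ξ p ω) ∧ a p (ξ p ω) ≤ A ∧ ∀ s ∈ S p, ∀ s' ∈ S p,
      |f p (ξ p ω) s - f p (ξ p ω) s'| ≤ a p (ξ p ω) * |s - s'|)
    (hf0 : ∀ p x, f p x 0 = 0) (hS0 : ∀ p, 0 ∈ S p)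
    (hκ : ∀ p, ∫⁻ ω, ENNReal.ofReal (a p (ξ p ω) ^ 2) ∂μ ≤ ENNReal.ofReal (κ ^ 2))
    (hA : c * (r * b * (2 * A)) ≤ 1)
    (𝒯 : Set (Matrix (Fin m) (Fin n) ℝ))
    (h𝒯 : ∀ D ∈ 𝒯, D.rank ≤ r ∧ ∀ i j, |D i j| ≤ b ∧ D i j ∈ S (i, j)) :
    μ {ω | ∃ D ∈ 𝒯, u ≤ ∑ p, (f p (ξ p ω) (D p.1 p.2) - ∫ ω', f p (ξ p ω') (D p.1 p.2) ∂μ)} ≤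
      ENNReal.ofReal (2 ^ (m + n) * Real.exp (4 * (c * (r * b)) ^ 2 * κ ^ 2 * (m * n)) *
        Real.exp (-(c * (u / 2)))) := by
  set ε := u / (4 * (A + 1) * (m * n + 1)) with hε
  have hε0 : 0 < ε := by positivity
  obtain ⟨F, hFs, hfin, hnet⟩ := exists_finite_entrywise_net 𝒯
    (fun D hD i j => ((h𝒯 D hD).2 i j).1) hε0
  refine le_trans (measure_mono_ae ?_) (measure_finite_process_ge_le μ hr0 (b := b) (A := A)
    (κ := κ) (c := c) (u := u / 2) hb hc ξ hξ hind f a S hf ha hbd hf0 hS0 hκ hA F hfin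
    (fun D hD => h𝒯 D (hFs hD)))
  have hlip : ∀ p, ∀ s ∈ S p, ∀ s' ∈ S p, ∀ᵐ ω ∂μ,
      ‖f p (ξ p ω) s - f p (ξ p ω) s'‖ ≤ A * |s - s'| := by
    intro p s hs s' hs'
    filter_upwards [hbd] with ω hω
    obtain ⟨h0, h1, h2⟩ := hω p
    exact (h2 s hs s' hs').trans (mul_le_mul_of_nonneg_right h1 (abs_nonneg _))
  have hint : ∀ p, ∀ s ∈ S p, Integrable (fun ω => f p (ξ p ω) s) μ := by
    intro p s hs
    refine Integrable.of_bound ((hf p s).comp (hξ p)).aestronglyMeasurable (A * |s - 0|) ?_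
    filter_upwards [hlip p s hs 0 (hS0 p)] with ω hω
    rwa [hf0, sub_zero] at hω
  have hE : ∀ p, ∀ s ∈ S p, ∀ s' ∈ S p,
      |∫ ω, f p (ξ p ω) s ∂μ - ∫ ω, f p (ξ p ω) s' ∂μ| ≤ A * |s - s'| := by
    intro p s hs s' hs'
    rw [← integral_sub (hint p s hs) (hint p s' hs')]
    simpa using norm_integral_le_of_norm_le_const (hlip p s hs s' hs')
  filter_upwards [hbd] with ω hω
  rintro ⟨D, hD, hDu⟩
  obtain ⟨D', hD', hclose⟩ := hnet D hD
  refine ⟨D', hD', ?_⟩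
  have hterm : ∀ p : Fin m × Fin n,
      (f p (ξ p ω) (D p.1 p.2) - ∫ ω', f p (ξ p ω') (D p.1 p.2) ∂μ) -
      (f p (ξ p ω) (D' p.1 p.2) - ∫ ω', f p (ξ p ω') (D' p.1 p.2) ∂μ) ≤ 2 * A * ε := by
    intro p
    have m1 := ((h𝒯 D hD).2 p.1 p.2).2
    have m2 := ((h𝒯 D' (hFs hD')).2 p.1 p.2).2
    have h1 := (abs_le.1 (hE p _ m1 _ m2)).1
    have h2 := (le_abs_self _).trans ((hω p).2.2 _ m1 _ m2)
    have h3 := mul_le_mul_of_nonneg_right (hω p).2.1 (abs_nonneg (D p.1 p.2 - D' p.1 p.2))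
    have h4 := mul_le_mul_of_nonneg_left (hclose p.1 p.2) hA0
    linarith
  have hsum := Finset.sum_le_sum fun p (_ : p ∈ Finset.univ) => hterm p
  rw [Finset.sum_sub_distrib] at hsum
  have hcard : ∑ _p : Fin m × Fin n, 2 * A * ε = m * n * (2 * A * ε) := by simp
  rw [hcard] at hsum
  have hsmall : m * n * (2 * A * ε) ≤ u / 2 := by
    rw [hε]
    rw [show (m * n * (2 * A * (u / (4 * (A + 1) * (m * n + 1)))) : ℝ) =
      u / 2 * (A / (A + 1)) * (m * n / (m * n + 1)) by field_simp; ring]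
    have e1 : A / (A + 1) ≤ 1 := div_le_one_of_le₀ (by linarith) (by linarith)
    have e2 : (m * n / (m * n + 1) : ℝ) ≤ 1 := div_le_one_of_le₀ (by linarith) (by positivity)
    calc _ ≤ u / 2 * 1 * 1 := by gcongr
      _ = _ := by ring
  linarith

end ProcessTail

/-! ### Deterministic facts on the objective, ranks and norms -/

theorem sigmoid_mul_one_sub (x : ℝ) :
    Real.sigmoid x * (1 - Real.sigmoid x) = (2 + 2 * Real.cosh x)⁻¹ := by
  rw [← Real.sigmoid_neg, Real.sigmoid_def, Real.sigmoid_def, neg_neg, ← mul_inv, Real.cosh_eq]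
  congr 1
  have : Real.exp (-x) * Real.exp x = 1 := by rw [← Real.exp_add]; simp
  nlinarith

theorem exp_div_one_add_exp_sq (x : ℝ) :
    Real.exp x / (1 + Real.exp x) ^ 2 = (2 + 2 * Real.cosh x)⁻¹ := by
  rw [Real.cosh_eq, Real.exp_neg]
  have := Real.exp_pos x
  field_simp
  ring

theorem log_sigmoid_sub_log_one_sub (x : ℝ) :
    Real.log (Real.sigmoid x) - Real.log (1 - Real.sigmoid x) = x := by
  have h1 := Real.sigmoid_pos x
  have h2 : 0 < 1 - Real.sigmoid x := by linarith [Real.sigmoid_lt_one x]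
  rw [← Real.log_div h1.ne' h2.ne', ← Real.sigmoid_neg, ← Real.sigmoid_mul_rexp_neg,
    div_mul_cancel_left₀ h1.ne', Real.exp_neg, inv_inv, Real.log_exp]

theorem hasDerivAt_log_one_sub_sigmoid (x : ℝ) :
    HasDerivAt (fun y => Real.log (1 - Real.sigmoid y)) (-Real.sigmoid x) x := by
  have h2 : 0 < 1 - Real.sigmoid x := by linarith [Real.sigmoid_lt_one x]
  have := ((Real.hasDerivAt_sigmoid x).const_sub 1).log h2.ne'
  convert this using 1
  field_simp

/-- A function whose derivative grows at rate at least `k` on an interval lies above its tangent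
parabola of curvature `k`. -/
theorem quadratic_lower_bound {G G' : ℝ → ℝ} {k α a x : ℝ}
    (hG : ∀ y, HasDerivAt G (G' y) y)
    (hG' : ∀ y ∈ Set.Icc (-α) α, ∀ z ∈ Set.Icc (-α) α, y ≤ z → k * (z - y) ≤ G' z - G' y)
    (ha : a ∈ Set.Icc (-α) α) (hx : x ∈ Set.Icc (-α) α) :
    k / 2 * (x - a) ^ 2 ≤ G x - G a - G' a * (x - a) := by
  set q : ℝ → ℝ := fun y => G y - G' a * (y - a) - k / 2 * (y - a) ^ 2 with hq
  have hqd : ∀ y, HasDerivAt q (G' y - G' a - k * (y - a)) y := by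
    intro y
    have h1 : HasDerivAt (fun y => y - a) 1 y := (hasDerivAt_id y).sub_const a
    have h2 := ((hG y).fun_sub (h1.const_mul (G' a))).fun_sub ((h1.fun_pow 2).const_mul (k / 2))
    refine h2.congr_deriv ?_
    norm_num
    ring
  have hqc : Continuous q := continuous_iff_continuousAt.2 fun y => (hqd y).continuousAt
  have hmin : q a ≤ q x := by
    rcases le_total a x with h | h
    · refine monotoneOn_of_deriv_nonneg (convex_Icc a x) hqc.continuousOn
        (fun y _ => (hqd y).differentiableAt.differentiableWithinAt) (fun y hy => ?_)
        (Set.left_mem_Icc.2 h) (Set.right_mem_Icc.2 h) h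
      rw [interior_Icc] at hy
      rw [(hqd y).deriv]
      have := hG' a ha y ⟨ha.1.trans hy.1.le, hy.2.le.trans hx.2⟩ hy.1.le
      linarith
    · refine antitoneOn_of_deriv_nonpos (convex_Icc x a) hqc.continuousOn
        (fun y _ => (hqd y).differentiableAt.differentiableWithinAt) (fun y hy => ?_)
        (Set.left_mem_Icc.2 h) (Set.right_mem_Icc.2 h) h
      rw [interior_Icc] at hy
      rw [(hqd y).deriv]
      have := hG' y ⟨hx.1.trans hy.1.le, hy.2.le.trans ha.2⟩ a ha hy.2.le
      linarith
  simp only [hq, sub_self] at hmin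
  linarith

/-- Strong convexity of the log-partition function `-log (1 - expit θ)` on `[-α, α]`. -/
theorem log_one_sub_sigmoid_curvature {α θ₀ θ : ℝ} (h₀ : |θ₀| ≤ α) (h : |θ| ≤ α) :
    Real.exp α / (2 * (1 + Real.exp α) ^ 2) * (θ - θ₀) ^ 2 ≤
      Real.log (1 - Real.sigmoid θ₀) - Real.log (1 - Real.sigmoid θ) -
        Real.sigmoid θ₀ * (θ - θ₀) := by
  have hcurv : ∀ y ∈ Set.Icc (-α) α, ∀ z ∈ Set.Icc (-α) α, y ≤ z →
      Real.exp α / (1 + Real.exp α) ^ 2 * (z - y) ≤ Real.sigmoid z - Real.sigmoid y := by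
    intro y hy z hz hyz
    refine (convex_Icc (-α) α).mul_sub_le_image_sub_of_le_deriv
      continuous_sigmoid.continuousOn
      (fun _ _ => (Real.hasDerivAt_sigmoid _).differentiableAt.differentiableWithinAt)
      (fun u hu => ?_) y hy z hz hyz
    rw [(Real.hasDerivAt_sigmoid u).deriv, sigmoid_mul_one_sub, exp_div_one_add_exp_sq]
    rw [interior_Icc] at hu
    have h1 : |u| ≤ |α| := (abs_le.2 ⟨hu.1.le, hu.2.le⟩).trans (le_abs_self α)
    have := Real.cosh_le_cosh.2 h1
    have := Real.cosh_pos u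
    gcongr
  have := quadratic_lower_bound (G := fun y => -Real.log (1 - Real.sigmoid y))
    (G' := Real.sigmoid)
    (fun y => (neg_neg (Real.sigmoid y)) ▸ (hasDerivAt_log_one_sub_sigmoid y).fun_neg) hcurv
    (abs_le.1 h₀) (abs_le.1 h)
  have e : Real.exp α / (2 * (1 + Real.exp α) ^ 2) =
      Real.exp α / (1 + Real.exp α) ^ 2 / 2 := by
    rw [div_div, mul_comm 2]
  rw [e]
  linarith

/-- Since the logit of `expit θ` is `θ`, the data enter the `Θ`-part of the objective linearly. -/
theorem negLogLik_sub {n₁ n₂ : ℕ} (l : Fin n₁ → Fin n₂ → ℝ → ℝ → ℝ) (η : ℝ)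
    (w x : Fin n₁ → Fin n₂ → ℝ) (M Θ M' Θ' : Matrix (Fin n₁) (Fin n₂) ℝ) :
    negLogLik l η w x M Θ - negLogLik l η w x M' Θ' =
      ∑ p : Fin n₁ × Fin n₂, (w p.1 p.2 * (η * (l p.1 p.2 (x p.1 p.2) (M' p.1 p.2) -
          l p.1 p.2 (x p.1 p.2) (M p.1 p.2))) + w p.1 p.2 * (Θ' p.1 p.2 - Θ p.1 p.2) +
        (Real.log (1 - Real.sigmoid (Θ' p.1 p.2)) - Real.log (1 - Real.sigmoid (Θ p.1 p.2)))) := by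
  unfold negLogLik
  rw [neg_sub_neg, Fintype.sum_prod_type, ← Finset.sum_sub_distrib]
  refine Finset.sum_congr rfl fun i _ => ?_
  rw [← Finset.sum_sub_distrib]
  refine Finset.sum_congr rfl fun j _ => ?_
  have h1 := log_sigmoid_sub_log_one_sub (Θ i j)
  have h2 := log_sigmoid_sub_log_one_sub (Θ' i j)
  linear_combination w i j * (h2 - h1)

theorem matrix_rank_add_le {m n : ℕ} (A B : Matrix (Fin m) (Fin n) ℝ) :
    (A + B).rank ≤ A.rank + B.rank := by
  unfold Matrix.rank
  rw [Matrix.mulVecLin_add]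
  exact (Submodule.finrank_mono (LinearMap.range_add_le _ _)).trans
    (Submodule.finrank_add_le_finrank_add_finrank _ _)

theorem rank_le_of_hasSharedFactorForm {n₁ n₂ ds dm dθ : ℕ} {M Θ : Matrix (Fin n₁) (Fin n₂) ℝ}
    (h : HasSharedFactorForm ds dm dθ M Θ) :
    M.rank ≤ ds + dm + dθ ∧ Θ.rank ≤ ds + dm + dθ := by
  obtain ⟨A, B, C, D, Fs, Fm, Fθ, rfl, rfl, -⟩ := h
  have key : ∀ {k : ℕ} (U : Matrix (Fin n₁) (Fin k) ℝ) (V : Matrix (Fin k) (Fin n₂) ℝ),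
      (U * V).rank ≤ k := fun U V => (rank_mul_le_left U V).trans (rank_le_width U)
  constructor
  · exact (matrix_rank_add_le _ _).trans ((add_le_add (key _ _) (key _ _)).trans (by omega))
  · exact (matrix_rank_add_le _ _).trans ((add_le_add (key _ _) (key _ _)).trans (by omega))

theorem rank_sub_le_of_hasSharedFactorForm {n₁ n₂ ds dm dθ : ℕ}
    {M Θ M' Θ' : Matrix (Fin n₁) (Fin n₂) ℝ} (h : HasSharedFactorForm ds dm dθ M Θ)
    (h' : HasSharedFactorForm ds dm dθ M' Θ') :
    (M - M').rank ≤ 2 * (ds + dm + dθ) ∧ (Θ - Θ').rank ≤ 2 * (ds + dm + dθ) := by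
  have h1 := rank_le_of_hasSharedFactorForm h
  have h2 := rank_le_of_hasSharedFactorForm h'
  have hs : ∀ A B : Matrix (Fin n₁) (Fin n₂) ℝ, (A - B).rank ≤ A.rank + B.rank := by
    intro A B
    have h3 := matrix_rank_add_le A ((-1 : ℝ) • B)
    rw [rank_smul_of_mem_nonZeroDivisors _ (mem_nonZeroDivisors_of_ne_zero (by norm_num))] at h3
    simpa [sub_eq_add_neg] using h3
  exact ⟨(hs _ _).trans (by omega), (hs _ _).trans (by omega)⟩

theorem abs_le_maxNorm {ι κ : Type*} [Fintype ι] [Fintype κ] (A : Matrix ι κ ℝ) (i : ι) (j : κ) :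
    |A i j| ≤ maxNorm A :=
  le_ciSup (f := fun p : ι × κ => |A p.1 p.2|) (Set.finite_range _).bddAbove (i, j)

theorem maxNorm_nonneg {ι κ : Type*} [Fintype ι] [Fintype κ] (A : Matrix ι κ ℝ) :
    0 ≤ maxNorm A :=
  Real.iSup_nonneg fun _ => abs_nonneg _

theorem maxNorm_pos {ι κ : Type*} [Fintype ι] [Fintype κ] {A : Matrix ι κ ℝ} (hA : A ≠ 0) :
    0 < maxNorm A := by
  refine lt_of_le_of_ne (maxNorm_nonneg A) fun h => hA ?_
  ext i j
  have := abs_le_maxNorm A i j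
  rw [← h] at this
  simpa using this

theorem frob_sq {ι κ : Type*} [Fintype ι] [Fintype κ] (A : Matrix ι κ ℝ) :
    frob A ^ 2 = ∑ i, ∑ j, A i j ^ 2 :=
  Real.sq_sqrt (Finset.sum_nonneg fun _ _ => Finset.sum_nonneg fun _ _ => sq_nonneg _)

theorem frob_nonneg {ι κ : Type*} [Fintype ι] [Fintype κ] (A : Matrix ι κ ℝ) : 0 ≤ frob A :=
  Real.sqrt_nonneg _

theorem frob_zero {ι κ : Type*} [Fintype ι] [Fintype κ] : frob (0 : Matrix ι κ ℝ) = 0 := by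
  simp [frob]

theorem frob_pos {ι κ : Type*} [Fintype ι] [Fintype κ] {A : Matrix ι κ ℝ} (hA : A ≠ 0) :
    0 < frob A := by
  refine lt_of_le_of_ne (frob_nonneg A) fun h => hA ?_
  have h2 := frob_sq A
  rw [← h, zero_pow two_ne_zero] at h2
  ext i j
  have h3 : A i j ^ 2 ≤ ∑ i, ∑ j, A i j ^ 2 :=
    (Finset.single_le_sum (f := fun j => A i j ^ 2) (fun _ _ => sq_nonneg _)
      (Finset.mem_univ j)).trans
    (Finset.single_le_sum (f := fun i => ∑ j, A i j ^ 2)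
      (fun _ _ => Finset.sum_nonneg fun _ _ => sq_nonneg _) (Finset.mem_univ i))
  rw [← h2] at h3
  simpa using le_antisymm h3 (sq_nonneg _)

theorem frob_fromRows_sq {n₁ n₂ : ℕ} (A B : Matrix (Fin n₁) (Fin n₂) ℝ) :
    frob (fromRows A B) ^ 2 =
      ∑ p : Fin n₁ × Fin n₂, A p.1 p.2 ^ 2 + ∑ p : Fin n₁ × Fin n₂, B p.1 p.2 ^ 2 := by
  rw [frob_sq, Fintype.sum_sum_type, Fintype.sum_prod_type, Fintype.sum_prod_type]
  simp

theorem frob_le_mul_maxNorm {n₁ n₂ : ℕ} (A : Matrix (Fin n₁ ⊕ Fin n₁) (Fin n₂) ℝ) :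
    frob A ≤ ((n₁ : ℝ) + n₂) * maxNorm A := by
  refine le_of_sq_le_sq ?_ (mul_nonneg (by positivity) (maxNorm_nonneg A))
  rw [frob_sq]
  calc ∑ i, ∑ j, A i j ^ 2 ≤ ∑ _i : Fin n₁ ⊕ Fin n₁, ∑ _j : Fin n₂, maxNorm A ^ 2 := by
        refine Finset.sum_le_sum fun i _ => Finset.sum_le_sum fun j _ => ?_
        rw [← sq_abs]
        exact pow_le_pow_left₀ (abs_nonneg _) (abs_le_maxNorm A i j) 2
    _ = 2 * (n₁ * n₂) * maxNorm A ^ 2 := by simp; ring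
    _ ≤ (((n₁ : ℝ) + n₂) * maxNorm A) ^ 2 := by
        rw [mul_pow]
        exact mul_le_mul_of_nonneg_right (by nlinarith [sq_nonneg (n₁ : ℝ), sq_nonneg (n₂ : ℝ)])
          (sq_nonneg _)

theorem err_eq_fromRows {n₁ n₂ : ℕ} {Ω : Type*} (Mhat Θhat : Ω → Matrix (Fin n₁) (Fin n₂) ℝ)
    (M Θ : Matrix (Fin n₁) (Fin n₂) ℝ) (ω : Ω) :
    err Mhat Θhat M Θ ω = fromRows (Mhat ω - M) (Θhat ω - Θ) := by
  ext i j
  rcases i with i | i <;> simp [err]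

theorem sum_abs_le_sqrt_mul {ι : Type*} [Fintype ι] (s : ι → ℝ) :
    ∑ p, |s p| ≤ Real.sqrt (Fintype.card ι) * Real.sqrt (∑ p, s p ^ 2) := by
  rw [← Real.sqrt_mul (Nat.cast_nonneg _)]
  refine Real.le_sqrt_of_sq_le ?_
  have := sq_sum_le_card_mul_sum_sq (s := Finset.univ) (f := fun p => |s p|)
  simpa using this

/-! ### Independence, moments and increments of the loss -/

/-- If two families are independent of each other and each consists of independent variables, the
pairs are independent. -/
theorem iIndepFun_prodMk_of_indepFun {Ω I α β : Type*} [MeasurableSpace Ω] [MeasurableSpace α]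
    [MeasurableSpace β] [Fintype I] {μ : Measure Ω} [IsProbabilityMeasure μ] {w : I → Ω → α}
    {x : I → Ω → β} (hw : ∀ p, Measurable (w p)) (hx : ∀ p, Measurable (x p))
    (hiw : iIndepFun w μ) (hix : iIndepFun x μ)
    (hwx : IndepFun (fun ω p => w p ω) (fun ω p => x p ω) μ) :
    iIndepFun (fun p ω => (w p ω, x p ω)) μ := by
  have hpw : ∀ p, IsProbabilityMeasure (μ.map (w p)) :=
    fun p => Measure.isProbabilityMeasure_map (hw p).aemeasurable
  have hpx : ∀ p, IsProbabilityMeasure (μ.map (x p)) :=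
    fun p => Measure.isProbabilityMeasure_map (hx p).aemeasurable
  have hW : Measurable fun ω p => w p ω := measurable_pi_lambda _ hw
  have hX : Measurable fun ω p => x p ω := measurable_pi_lambda _ hx
  have hmarg : ∀ p, μ.map (fun ω => (w p ω, x p ω)) = (μ.map (w p)).prod (μ.map (x p)) := by
    intro p
    have : IndepFun (w p) (x p) μ :=
      hwx.comp (φ := fun f : I → α => f p) (ψ := fun f : I → β => f p)
        (measurable_pi_apply p) (measurable_pi_apply p)
    exact (indepFun_iff_map_prod_eq_prod_map_map (hw p).aemeasurable (hx p).aemeasurable).1 this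
  rw [iIndepFun_iff_map_fun_eq_pi_map fun p => ((hw p).prodMk (hx p)).aemeasurable]
  simp_rw [hmarg]
  have h1 := measurePreserving_arrowProdEquivProdArrow α β I (fun p => μ.map (w p))
    (fun p => μ.map (x p))
  have h2 := (indepFun_iff_map_prod_eq_prod_map_map hW.aemeasurable hX.aemeasurable).1 hwx
  rw [(iIndepFun_iff_map_fun_eq_pi_map fun p => (hw p).aemeasurable).1 hiw,
    (iIndepFun_iff_map_fun_eq_pi_map fun p => (hx p).aemeasurable).1 hix] at h2
  have h3 := (h1.symm (MeasurableEquiv.arrowProdEquivProdArrow α β I)).map_eq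
  rw [← h3, ← h2, Measure.map_map (MeasurableEquiv.measurable _) (hW.prodMk hX)]
  rfl

section Moments

variable {Ω : Type*} [MeasurableSpace Ω] {μ : Measure Ω} {g : Ω → ℝ} {q α : ℝ}

theorem integral_abs_rpow_le (hg : Measurable g) (hq : 0 < q) (hα : 0 ≤ α)
    (h : eLpNorm g (ENNReal.ofReal q) μ ≤ ENNReal.ofReal α) :
    Integrable (fun ω => |g ω| ^ q) μ ∧ ∫ ω, |g ω| ^ q ∂μ ≤ α ^ q := by
  rw [eLpNorm_eq_lintegral_rpow_enorm_toReal (by simpa using hq) (by simp),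
    ENNReal.toReal_ofReal hq.le, one_div] at h
  have h1 : ∫⁻ ω, ENNReal.ofReal (|g ω| ^ q) ∂μ ≤ ENNReal.ofReal (α ^ q) := by
    rw [← ENNReal.ofReal_rpow_of_nonneg hα hq.le]
    have := ENNReal.rpow_le_rpow h hq.le
    rw [← ENNReal.rpow_mul, inv_mul_cancel₀ hq.ne', ENNReal.rpow_one] at this
    refine le_trans (le_of_eq (lintegral_congr fun ω => ?_)) this
    rw [← ENNReal.ofReal_rpow_of_nonneg (abs_nonneg _) hq.le, Real.enorm_eq_ofReal_abs]
  have hm : Measurable fun ω => |g ω| ^ q := hg.abs.pow_const q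
  have h0 : ∀ ω, 0 ≤ |g ω| ^ q := fun ω => Real.rpow_nonneg (abs_nonneg _) _
  refine ⟨⟨hm.aestronglyMeasurable, ?_⟩, ?_⟩
  · rw [hasFiniteIntegral_iff_ofReal (Filter.Eventually.of_forall h0)]
    exact h1.trans_lt ENNReal.ofReal_lt_top
  · rw [integral_eq_lintegral_of_nonneg_ae (Filter.Eventually.of_forall h0)
      hm.aestronglyMeasurable]
    exact ENNReal.toReal_le_of_le_ofReal (by positivity) h1

/-- Truncated moments: above the level `α * √N` a variable with `L^q` norm at most `α` has
`k`-th moment at most `α ^ k * N ^ (-(q - k) / 2)`. -/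
theorem integral_truncated_rpow_le (hg : Measurable g) (hα : 0 < α) {N k : ℝ} (hN : 0 < N)
    (hkq : k ≤ q) (hq : 0 < q)
    (h : eLpNorm g (ENNReal.ofReal q) μ ≤ ENNReal.ofReal α) :
    Integrable (fun ω => if |g ω| ≤ α * Real.sqrt N then 0 else |g ω| ^ k) μ ∧
    ∫ ω, (if |g ω| ≤ α * Real.sqrt N then 0 else |g ω| ^ k) ∂μ ≤
      α ^ k * N ^ (-((q - k) / 2)) := by
  obtain ⟨hint, hle⟩ := integral_abs_rpow_le hg hq hα.le h
  set τ := α * Real.sqrt N with hτ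
  have hτ0 : 0 < τ := by positivity
  have hpt : ∀ ω, (if |g ω| ≤ τ then 0 else |g ω| ^ k) ≤ τ ^ (-(q - k)) * |g ω| ^ q := by
    intro ω
    split_ifs with hc
    · positivity
    · have hlt := not_le.1 hc
      have hg0 := hτ0.trans hlt
      have e : |g ω| ^ k = |g ω| ^ (-(q - k)) * |g ω| ^ q := by
        rw [← Real.rpow_add hg0]; congr 1; ring
      rw [e]
      refine mul_le_mul_of_nonneg_right ?_ (Real.rpow_nonneg (abs_nonneg _) _)
      exact Real.rpow_le_rpow_of_nonpos hτ0 hlt.le (by linarith)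
  have hpt0 : ∀ ω, 0 ≤ (if |g ω| ≤ τ then 0 else |g ω| ^ k) := by
    intro ω
    split_ifs
    · exact le_rfl
    · positivity
  have hm : Measurable fun ω => if |g ω| ≤ τ then 0 else |g ω| ^ k :=
    Measurable.ite (measurableSet_le hg.abs measurable_const) measurable_const
      (hg.abs.pow_const k)
  have hi : Integrable (fun ω => if |g ω| ≤ τ then 0 else |g ω| ^ k) μ := by
    refine (hint.const_mul (τ ^ (-(q - k)))).mono' hm.aestronglyMeasurable
      (Filter.Eventually.of_forall fun ω => ?_)
    rw [Real.norm_eq_abs, abs_of_nonneg (hpt0 ω)]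
    exact hpt ω
  refine ⟨hi, ?_⟩
  calc _ ≤ ∫ ω, τ ^ (-(q - k)) * |g ω| ^ q ∂μ :=
        integral_mono hi (hint.const_mul _) hpt
    _ = τ ^ (-(q - k)) * ∫ ω, |g ω| ^ q ∂μ := integral_const_mul _ _
    _ ≤ τ ^ (-(q - k)) * α ^ q := mul_le_mul_of_nonneg_left hle (by positivity)
    _ = _ := by
        rw [hτ, Real.mul_rpow hα.le (Real.sqrt_nonneg _), Real.sqrt_eq_rpow,
          ← Real.rpow_mul hN.le, mul_right_comm, ← Real.rpow_add hα]
        congr 2 <;> ring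

/-- The case `k = 0` of `integral_truncated_rpow_le`, which is Markov's inequality. -/
theorem measureReal_truncation_le [IsProbabilityMeasure μ] (hg : Measurable g) (hα : 0 < α)
    {N : ℝ} (hN : 0 < N) (hq : 0 < q) (h : eLpNorm g (ENNReal.ofReal q) μ ≤ ENNReal.ofReal α) :
    μ.real {ω | ¬ |g ω| ≤ α * Real.sqrt N} ≤ N ^ (-(q / 2)) := by
  have h1 := (integral_truncated_rpow_le hg hα hN hq.le hq h).2
  have hs : MeasurableSet {ω | ¬ |g ω| ≤ α * Real.sqrt N} :=
    (measurableSet_le hg.abs measurable_const).compl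
  rw [Real.rpow_zero, one_mul, sub_zero] at h1
  refine le_trans (le_of_eq ?_) h1
  rw [← integral_indicator_one hs]
  refine integral_congr_ae (Filter.Eventually.of_forall fun ω => ?_)
  by_cases hc : |g ω| ≤ α * Real.sqrt N
  · simp [Set.indicator, hc]
  · simp only [Set.indicator, Set.mem_ofPred_eq, hc, not_false_eq_true, if_true, if_false,
      Real.rpow_zero, Pi.one_apply]

theorem lintegral_scaled_shifted_sq_le [IsProbabilityMeasure μ] (hg : Measurable g) {B η : ℝ}
    (hα : 0 ≤ α) (hB : 0 ≤ B) (hq : 2 ≤ q)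
    (h : eLpNorm g (ENNReal.ofReal q) μ ≤ ENNReal.ofReal α) :
    ∫⁻ ω, ENNReal.ofReal ((η * (|g ω| + B)) ^ 2) ∂μ ≤
      ENNReal.ofReal ((η * (α + B)) ^ 2) := by
  have h2 : eLpNorm (fun ω => |g ω| + B) 2 μ ≤ ENNReal.ofReal (α + B) := by
    have e1 := eLpNorm_add_le (μ := μ) (p := 2) (f := fun ω => |g ω|) (g := fun _ => B)
      hg.abs.aestronglyMeasurable aestronglyMeasurable_const (by norm_num)
    have e2 : eLpNorm (fun ω => |g ω|) 2 μ ≤ ENNReal.ofReal α := by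
      have : eLpNorm (fun ω => |g ω|) 2 μ = eLpNorm g 2 μ := eLpNorm_norm g
      rw [this]
      refine (eLpNorm_le_eLpNorm_of_exponent_le ?_ hg.aestronglyMeasurable).trans h
      rw [← ENNReal.ofReal_ofNat 2]
      exact ENNReal.ofReal_le_ofReal hq
    have e3 : eLpNorm (fun _ : Ω => B) 2 μ = ENNReal.ofReal B := by
      rw [eLpNorm_const' _ (by norm_num) (by norm_num)]
      simp [Real.enorm_eq_ofReal_abs, abs_of_nonneg hB]
    rw [e3] at e1
    rw [ENNReal.ofReal_add hα hB]
    exact e1.trans (add_le_add e2 le_rfl)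
  have h3 := (integral_abs_rpow_le (μ := μ) (α := α + B) (g := fun ω => |g ω| + B)
    (hg.abs.add_const B)
    (q := 2) (by norm_num) (by positivity) (by simpa using h2))
  have h4 : ∀ ω, |(|g ω| + B)| ^ (2 : ℝ) = (|g ω| + B) ^ 2 := fun ω => by
    rw [abs_of_nonneg (by positivity)]; norm_cast
  simp_rw [h4] at h3
  simp_rw [mul_pow]
  rw [← ofReal_integral_eq_lintegral_ofReal (h3.1.const_mul _)
    (Filter.Eventually.of_forall fun ω => by positivity), integral_const_mul]
  refine ENNReal.ofReal_le_ofReal (mul_le_mul_of_nonneg_left ?_ (by positivity))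
  have h5 := h3.2
  norm_cast at h5

end Moments

/-- The derivative in the second argument is a pointwise limit of difference quotients, hence
measurable in the first; no joint measurability is needed. -/
theorem measurable_deriv_of_measurable_family {f : ℝ → ℝ → ℝ} (hf : ∀ m, Measurable fun y => f y m)
    (hd : ∀ y, Differentiable ℝ (f y)) (m : ℝ) : Measurable fun y => deriv (f y) m := by
  have hlim : Filter.Tendsto (fun n : ℕ => (1 / ((n : ℝ) + 1))) Filter.atTop
      (nhdsWithin 0 {0}ᶜ) := by
    refine tendsto_nhdsWithin_iff.2 ⟨tendsto_one_div_add_atTop_nhds_zero_nat,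
      Filter.Eventually.of_forall fun n => ?_⟩
    have : (1 / ((n : ℝ) + 1)) ≠ 0 := by positivity
    simpa using this
  refine measurable_of_tendsto_metrizable (f := fun (n : ℕ) y =>
    (1 / ((n : ℝ) + 1))⁻¹ • (f y (m + 1 / ((n : ℝ) + 1)) - f y m))
    (fun n => ((hf (m + 1 / ((n : ℝ) + 1))).fun_sub (hf m)).fun_const_smul _)
    (tendsto_pi_nhds.2 fun y => ?_)
  exact (hasDerivAt_iff_tendsto_slope_zero.1 (hd y m).hasDerivAt).comp hlim

theorem abs_sub_le_of_abs_deriv_le {f : ℝ → ℝ} (hf : Differentiable ℝ f) {a b C : ℝ}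
    (hC : ∀ y ∈ Set.uIcc a b, |deriv f y| ≤ C) : |f a - f b| ≤ C * |a - b| :=
  (convex_uIcc a b).norm_image_sub_le_of_norm_deriv_le (fun y _ => hf y) hC
    Set.right_mem_uIcc Set.left_mem_uIcc

/-- Increment bounds for a loss whose derivative is `L`-Lipschitz on `[-α, α]`. -/
theorem abs_loss_sub_le {f : ℝ → ℝ} (hf : Differentiable ℝ f) {α L m₀ a b ρ : ℝ} (hL : 0 ≤ L)
    (hlip : ∀ m ∈ Set.Icc (-α) α, ∀ m' ∈ Set.Icc (-α) α, |deriv f m - deriv f m'| ≤ L * |m - m'|)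
    (h₀ : m₀ ∈ Set.Icc (-α) α) (ha : a ∈ Set.Icc (-α) α) (hb : b ∈ Set.Icc (-α) α)
    (hρ : ∀ y ∈ Set.uIcc a b, |y - m₀| ≤ ρ) :
    |f a - f b| ≤ (|deriv f m₀| + L * ρ) * |a - b| := by
  refine abs_sub_le_of_abs_deriv_le hf fun y hy => ?_
  have hy' : y ∈ Set.Icc (-α) α := Set.uIcc_subset_Icc ha hb hy
  have h1 := hlip y hy' m₀ h₀
  have h2 := mul_le_mul_of_nonneg_left (hρ y hy) hL
  have h3 := abs_sub_abs_le_abs_sub (deriv f y) (deriv f m₀)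
  linarith

/-! ### The truncated increment of the loss -/

/-- The weighted increment `w * η * (l (x, m₀ + s) - l (x, m₀))` of the loss at the observation
`z = (w, x)`, set to zero when the derivative at `m₀` exceeds the level `τ`. -/
def truncIncr (l : ℝ → ℝ → ℝ) (m₀ τ η : ℝ) (z : ℝ × ℝ) (s : ℝ) : ℝ :=
  z.1 * (η * if |deriv (l z.2) m₀| ≤ τ then l z.2 (m₀ + s) - l z.2 m₀ else 0)

/-- A Lipschitz constant of `truncIncr` in `s`; `B` bounds the oscillation of the derivative. -/
def truncLip (l : ℝ → ℝ → ℝ) (m₀ τ η B : ℝ) (z : ℝ × ℝ) : ℝ :=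
  η * ((if |deriv (l z.2) m₀| ≤ τ then |deriv (l z.2) m₀| else 0) + B)

section Increment

variable {l : ℝ → ℝ → ℝ} {m₀ τ η B L αm : ℝ}

theorem measurable_truncIncr (hl : ∀ m, Measurable fun y => l y m)
    (hd : ∀ y, Differentiable ℝ (l y)) (s : ℝ) :
    Measurable fun z => truncIncr l m₀ τ η z s := by
  have hg : Measurable fun z : ℝ × ℝ => deriv (l z.2) m₀ :=
    (measurable_deriv_of_measurable_family hl hd m₀).comp measurable_snd
  refine measurable_fst.mul (Measurable.const_mul (Measurable.ite
    (measurableSet_le hg.abs measurable_const) ?_ measurable_const) η)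
  exact ((hl _).comp measurable_snd).sub ((hl _).comp measurable_snd)

theorem measurable_truncLip (hl : ∀ m, Measurable fun y => l y m)
    (hd : ∀ y, Differentiable ℝ (l y)) : Measurable (truncLip l m₀ τ η B) := by
  have hg : Measurable fun z : ℝ × ℝ => deriv (l z.2) m₀ :=
    (measurable_deriv_of_measurable_family hl hd m₀).comp measurable_snd
  exact Measurable.const_mul ((Measurable.ite (measurableSet_le hg.abs measurable_const) hg.abs
    measurable_const).add_const B) η

theorem truncLip_nonneg (hη : 0 ≤ η) (hB : 0 ≤ B) (z : ℝ × ℝ) : 0 ≤ truncLip l m₀ τ η B z := by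
  unfold truncLip
  split_ifs <;> positivity

theorem truncLip_le (hη : 0 ≤ η) (hτ : 0 ≤ τ) (z : ℝ × ℝ) :
    truncLip l m₀ τ η B z ≤ η * (τ + B) := by
  unfold truncLip
  split_ifs <;> gcongr

theorem truncLip_le_abs_deriv (hη : 0 ≤ η) (z : ℝ × ℝ) :
    truncLip l m₀ τ η B z ≤ η * (|deriv (l z.2) m₀| + B) := by
  unfold truncLip
  split_ifs
  · exact le_rfl
  · gcongr
    positivity

theorem abs_truncIncr_sub_le (hd : ∀ y, Differentiable ℝ (l y)) (hη : 0 ≤ η) (hL : 0 ≤ L)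
    {z : ℝ × ℝ} (hz : |z.1| ≤ 1)
    (hlip : ∀ m ∈ Set.Icc (-αm) αm, ∀ m' ∈ Set.Icc (-αm) αm,
      |deriv (l z.2) m - deriv (l z.2) m'| ≤ L * |m - m'|)
    (h₀ : m₀ ∈ Set.Icc (-αm) αm) {s s' : ℝ} (hs : m₀ + s ∈ Set.Icc (-αm) αm)
    (hs' : m₀ + s' ∈ Set.Icc (-αm) αm) :
    |truncIncr l m₀ τ η z s - truncIncr l m₀ τ η z s'| ≤
      truncLip l m₀ τ η (2 * L * αm) z * |s - s'| := by
  have hα : 0 ≤ αm := by linarith [h₀.1, h₀.2]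
  unfold truncIncr truncLip
  split_ifs with hc
  · have h1 := abs_loss_sub_le (hd z.2) (ρ := 2 * αm) hL hlip h₀ hs hs' (fun y hy => by
      have hy' := Set.uIcc_subset_Icc hs hs' hy
      rw [abs_le]
      constructor <;> linarith [hy'.1, hy'.2, h₀.1, h₀.2])
    have e1 : m₀ + s - (m₀ + s') = s - s' := by ring
    rw [e1] at h1
    have e2 : z.1 * (η * (l z.2 (m₀ + s) - l z.2 m₀)) - z.1 * (η * (l z.2 (m₀ + s') - l z.2 m₀)) =
        z.1 * (η * (l z.2 (m₀ + s) - l z.2 (m₀ + s'))) := by ring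
    rw [e2, abs_mul, abs_mul, abs_of_nonneg hη]
    calc _ ≤ 1 * (η * ((|deriv (l z.2) m₀| + L * (2 * αm)) * |s - s'|)) := by gcongr
      _ = _ := by ring
  · simp only [mul_zero, sub_self, abs_zero]
    positivity

end Increment

/-- The mean of a truncated increment: the curvature of the expected loss, up to the bias caused
by the truncation. -/
theorem integral_truncIncr_le {Ω : Type*} [MeasurableSpace Ω] {μ : Measure Ω}
    [IsProbabilityMeasure μ] {l : ℝ → ℝ → ℝ} {m₀ η L αm αl αδ N q p s : ℝ} {w x : Ω → ℝ}
    (hw : Measurable w) (hx : Measurable x) (hwx : IndepFun w x μ) (hwp : ∫ ω, w ω ∂μ = p)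
    (hp0 : 0 ≤ p) (hp1 : p ≤ 1) (hl : ∀ m, Measurable fun y => l y m)
    (hd : ∀ y, Differentiable ℝ (l y)) (hη : 0 ≤ η) (hL : 0 ≤ L) (hαδ : 0 < αδ) (hN : 0 < N)
    (hq : 1 ≤ q)
    (hlip : ∀ᵐ ω ∂μ, ∀ m ∈ Set.Icc (-αm) αm, ∀ m' ∈ Set.Icc (-αm) αm,
      |deriv (l (x ω)) m - deriv (l (x ω)) m'| ≤ L * |m - m'|)
    (hint : ∀ m ∈ Set.Icc (-αm) αm, Integrable (fun ω => l (x ω) m) μ)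
    (h₀ : m₀ ∈ Set.Icc (-αm) αm) (hs : m₀ + s ∈ Set.Icc (-αm) αm)
    (hex : αl * s ^ 2 ≤ p * (∫ ω, l (x ω) m₀ ∂μ - ∫ ω, l (x ω) (m₀ + s) ∂μ))
    (hmom : eLpNorm (fun ω => deriv (l (x ω)) m₀) (ENNReal.ofReal q) μ ≤ ENNReal.ofReal αδ) :
    ∫ ω, truncIncr l m₀ (αδ * Real.sqrt N) η (w ω, x ω) s ∂μ ≤
      -(η * αl * s ^ 2) +
        η * (αδ * N ^ (-((q - 1) / 2)) * |s| + L * N ^ (-(q / 2)) * s ^ 2) := by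
  set τ := αδ * Real.sqrt N with hτ
  have hgm : Measurable fun y => deriv (l y) m₀ := measurable_deriv_of_measurable_family hl hd m₀
  set g : Ω → ℝ := fun ω => deriv (l (x ω)) m₀ with hg
  have hgΩ : Measurable g := hgm.comp hx
  set D : Ω → ℝ := fun ω => l (x ω) (m₀ + s) - l (x ω) m₀ with hD
  have hDi : Integrable D μ := (hint _ hs).sub (hint _ h₀)
  set R : Ω → ℝ := fun ω => if |g ω| ≤ τ then 0 else D ω with hR
  have hT1 := integral_truncated_rpow_le (k := 1) hgΩ hαδ hN hq (by linarith) hmom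
  have hT0 := integral_truncated_rpow_le (k := 0) hgΩ hαδ hN (by linarith) (by linarith) hmom
  rw [← hτ] at hT1 hT0
  simp only [Real.rpow_one, Real.rpow_zero, one_mul, sub_zero] at hT1 hT0
  have hRm : Measurable R := Measurable.ite (measurableSet_le hgΩ.abs measurable_const)
    measurable_const (((hl _).comp hx).sub ((hl _).comp hx))
  have hRi : Integrable R μ := by
    refine hDi.mono hRm.aestronglyMeasurable (Filter.Eventually.of_forall fun ω => ?_)
    simp only [hR]
    split_ifs <;> simp
  have hRb : ∀ᵐ ω ∂μ, -(|s| * (if |g ω| ≤ τ then 0 else |g ω|) +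
      L * s ^ 2 * (if |g ω| ≤ τ then 0 else 1)) ≤ R ω := by
    filter_upwards [hlip] with ω hω
    simp only [hR]
    split_ifs with hc
    · simp
    · have h1 := abs_loss_sub_le (hd (x ω)) (ρ := |s|) hL hω h₀ hs h₀ (fun y hy => by
        have := Set.abs_sub_right_of_mem_uIcc hy
        rw [abs_sub_comm, abs_sub_comm m₀] at this
        simpa using this)
      rw [add_sub_cancel_left] at h1
      have h2 := (abs_le.1 h1).1
      have h3 : |s| * |s| = s ^ 2 := by rw [← sq, sq_abs]
      simp only [hD, hg]
      nlinarith
  have hRint : -(|s| * (αδ * N ^ (-((q - 1) / 2))) + L * s ^ 2 * N ^ (-(q / 2))) ≤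
      ∫ ω, R ω ∂μ := by
    refine le_trans ?_ (integral_mono_ae
      (((hT1.1.const_mul |s|).add (hT0.1.const_mul (L * s ^ 2))).neg) hRi hRb)
    have : ∫ ω, -(|s| * (if |g ω| ≤ τ then 0 else |g ω|) +
        L * s ^ 2 * (if |g ω| ≤ τ then 0 else 1)) ∂μ =
        -(|s| * ∫ ω, (if |g ω| ≤ τ then 0 else |g ω|) ∂μ +
          L * s ^ 2 * ∫ ω, (if |g ω| ≤ τ then (0 : ℝ) else 1) ∂μ) := by
      rw [integral_neg, integral_add (hT1.1.const_mul |s|) (hT0.1.const_mul (L * s ^ 2)),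
        integral_const_mul, integral_const_mul]
    refine le_trans ?_ this.ge
    have e1 := mul_le_mul_of_nonneg_left hT1.2 (abs_nonneg s)
    have e2 := mul_le_mul_of_nonneg_left hT0.2 (mul_nonneg hL (sq_nonneg s))
    linarith
  set h : ℝ → ℝ := fun y => η * if |deriv (l y) m₀| ≤ τ then l y (m₀ + s) - l y m₀ else 0 with hh
  have hhm : Measurable h := Measurable.const_mul (Measurable.ite
    (measurableSet_le hgm.abs measurable_const) ((hl _).sub (hl _)) measurable_const) η
  have hprod : ∫ ω, truncIncr l m₀ τ η (w ω, x ω) s ∂μ = p * ∫ ω, h (x ω) ∂μ := by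
    rw [← hwp]
    exact (hwx.comp measurable_id hhm).integral_fun_mul_eq_mul_integral
      hw.aestronglyMeasurable (hhm.comp hx).aestronglyMeasurable
  have hhx : ∫ ω, h (x ω) ∂μ = η * (∫ ω, D ω ∂μ - ∫ ω, R ω ∂μ) := by
    rw [← integral_sub hDi hRi, ← integral_const_mul]
    refine integral_congr_ae (Filter.Eventually.of_forall fun ω => ?_)
    by_cases hc : |g ω| ≤ τ
    · have hc' : |deriv (l (x ω)) m₀| ≤ τ := hc
      simp [hh, hR, hD, hc, hc']
    · have hc' : ¬ |deriv (l (x ω)) m₀| ≤ τ := hc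
      simp [hh, hR, hD, hc, hc']
  have hDint : ∫ ω, D ω ∂μ = ∫ ω, l (x ω) (m₀ + s) ∂μ - ∫ ω, l (x ω) m₀ ∂μ :=
    integral_sub (hint _ hs) (hint _ h₀)
  rw [hprod, hhx, hDint]
  set U := |s| * (αδ * N ^ (-((q - 1) / 2))) + L * s ^ 2 * N ^ (-(q / 2)) with hU
  have hU0 : 0 ≤ U := by positivity
  have f1 : p * -∫ ω, R ω ∂μ ≤ U := by
    calc p * -∫ ω, R ω ∂μ ≤ p * U := mul_le_mul_of_nonneg_left (by linarith) hp0
      _ ≤ 1 * U := mul_le_mul_of_nonneg_right hp1 hU0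
      _ = U := one_mul U
  have f2 := mul_le_mul_of_nonneg_left f1 hη
  have f3 := mul_le_mul_of_nonneg_left hex hη
  have f4 : η * (αδ * N ^ (-((q - 1) / 2)) * |s| + L * N ^ (-(q / 2)) * s ^ 2) = η * U := by
    rw [hU]; ring
  rw [f4]
  nlinarith

/-- For errors of Frobenius norm at least `N ^ (-δ / 2)` the truncation bias is at most half of the
curvature term. -/
theorem bias_le_half_curvature {n₁ n₂ N αθ αl αδ L η δ F S₁ S₂ : ℝ} (hN : 1 ≤ N)
    (hη : 0 < η) (hαδ : 0 < αδ) (hδ : 0 < δ) (hL : 0 < L)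
    (hconst : L / N ^ 2 + max αδ (1 / η) * (4 + δ) / (3 + δ) *
        (Real.sqrt (n₁ * n₂) / N ^ (3 / 2 : ℝ))
      ≤ 1 / 2 * min (Real.exp αθ / (2 * η * (1 + Real.exp αθ) ^ 2)) αl)
    (hF : N ^ (-(δ / 2)) ≤ F) (hS₁ : S₁ ≤ Real.sqrt (n₁ * n₂) * F) (hS₂ : S₂ ≤ F ^ 2) :
    η * (αδ * N ^ (-((4 + δ - 1) / 2)) * S₁ + L * N ^ (-((4 + δ) / 2)) * S₂) ≤
      αh αθ η αl / 2 * F ^ 2 := by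
  have hN0 : 0 < N := by linarith
  have hF0 : 0 < F := (Real.rpow_pos_of_pos hN0 _).trans_le hF
  set r := Real.sqrt (n₁ * n₂) with hr
  have hr0 : 0 ≤ r := Real.sqrt_nonneg _
  have e1 : N ^ (-((4 + δ - 1) / 2)) = N ^ (-(δ / 2)) / N ^ (3 / 2 : ℝ) := by
    rw [← Real.rpow_sub hN0]; congr 1; ring
  have e2 : N ^ (-((4 + δ) / 2)) ≤ 1 / N ^ 2 := by
    rw [one_div, ← Real.rpow_natCast, ← Real.rpow_neg hN0.le]
    exact Real.rpow_le_rpow_of_exponent_le hN (by push_cast; linarith)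
  have hP : 0 < N ^ (3 / 2 : ℝ) := Real.rpow_pos_of_pos hN0 _
  have h1 : αδ * N ^ (-((4 + δ - 1) / 2)) * S₁ ≤ αδ * (r / N ^ (3 / 2 : ℝ)) * F ^ 2 := by
    rw [e1]
    calc αδ * (N ^ (-(δ / 2)) / N ^ (3 / 2 : ℝ)) * S₁
        ≤ αδ * (F / N ^ (3 / 2 : ℝ)) * (r * F) := by
          have : 0 ≤ N ^ (-(δ / 2)) := Real.rpow_nonneg hN0.le _
          calc _ ≤ αδ * (N ^ (-(δ / 2)) / N ^ (3 / 2 : ℝ)) * (r * F) :=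
                mul_le_mul_of_nonneg_left hS₁ (by positivity)
            _ ≤ _ := by gcongr
      _ = _ := by ring
  have h2 : αδ ≤ max αδ (1 / η) * (4 + δ) / (3 + δ) := by
    rw [le_div_iff₀ (by linarith)]
    have h3 : αδ ≤ max αδ (1 / η) := le_max_left _ _
    nlinarith
  have h3 : αδ * (r / N ^ (3 / 2 : ℝ)) * F ^ 2 ≤
      max αδ (1 / η) * (4 + δ) / (3 + δ) * (r / N ^ (3 / 2 : ℝ)) * F ^ 2 := by
    gcongr
  have h4 : L * N ^ (-((4 + δ) / 2)) * S₂ ≤ L / N ^ 2 * F ^ 2 := by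
    calc _ ≤ L * N ^ (-((4 + δ) / 2)) * F ^ 2 :=
          mul_le_mul_of_nonneg_left hS₂ (by positivity)
      _ ≤ L * (1 / N ^ 2) * F ^ 2 := by gcongr
      _ = _ := by ring
  have h5 : η * min (Real.exp αθ / (2 * η * (1 + Real.exp αθ) ^ 2)) αl = αh αθ η αl := by
    rw [αh, mul_min_of_nonneg _ _ hη.le]
    congr 1
    have := Real.exp_pos αθ
    field_simp
  calc _ ≤ η * ((L / N ^ 2 + max αδ (1 / η) * (4 + δ) / (3 + δ) *
        (r / N ^ (3 / 2 : ℝ))) * F ^ 2) := by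
        refine mul_le_mul_of_nonneg_left ?_ hη.le
        linarith
    _ ≤ η * ((1 / 2 * min (Real.exp αθ / (2 * η * (1 + Real.exp αθ) ^ 2)) αl) * F ^ 2) := by
        gcongr
    _ = _ := by rw [← h5]; ring

/-! ### The basic inequality -/

section ModelFacts

variable {n₁ n₂ ds dm dθ : ℕ} {Ω : Type*} [MeasurableSpace Ω] {μ : Measure Ω}
  {P : Fin n₁ → Fin n₂ → ℝ → Measure ℝ}
  {M Θ : Matrix (Fin n₁) (Fin n₂) ℝ} {w x : Fin n₁ → Fin n₂ → Ω → ℝ}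
  {l : Fin n₁ → Fin n₂ → ℝ → ℝ → ℝ} {αm αθ η αl L δ αδ : ℝ}
  {Mhat Θhat : Ω → Matrix (Fin n₁) (Fin n₂) ℝ}

theorem Model.ae_abs_w_le_one (hmod : Model μ ds dm dθ P M Θ w x) :
    ∀ᵐ ω ∂μ, ∀ i j, |w i j ω| ≤ 1 := by
  refine ae_all_iff.2 fun i => ae_all_iff.2 fun j => ?_
  have h : ∀ᵐ y ∂(μ.map (w i j)), |y| ≤ 1 := by
    rw [(hmod.law_w i j).map_eq, bernoulliMeasure_def, ae_add_measure_iff]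
    constructor <;> refine Measure.ae_smul_measure ?_ _ <;> simp [ae_dirac_eq]
  exact ae_of_ae_map (hmod.measurable_w i j).aemeasurable h

theorem Model.integral_w (hmod : Model μ ds dm dθ P M Θ w x) (i : Fin n₁) (j : Fin n₂) :
    ∫ ω, w i j ω ∂μ = Real.sigmoid (Θ i j) := by
  have h := integral_map (μ := μ) (hmod.measurable_w i j).aemeasurable
    (f := fun y : ℝ => y) aestronglyMeasurable_id
  rw [← h, (hmod.law_w i j).map_eq, integral_bernoulliMeasure]
  simp only [smul_eq_mul, mul_one, mul_zero, add_zero]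
  rfl

theorem Model.indepFun (hmod : Model μ ds dm dθ P M Θ w x) (i : Fin n₁) (j : Fin n₂) :
    IndepFun (w i j) (x i j) μ :=
  hmod.indep_w_x.comp (φ := fun f : Fin n₁ × Fin n₂ → ℝ => f (i, j))
    (ψ := fun f : Fin n₁ × Fin n₂ → ℝ => f (i, j)) (measurable_pi_apply (i, j))
    (measurable_pi_apply (i, j))

theorem mem_Icc_of_maxNorm_le {A : Matrix (Fin n₁) (Fin n₂) ℝ} {α : ℝ} (h : maxNorm A ≤ α)
    (i : Fin n₁) (j : Fin n₂) : A i j ∈ Set.Icc (-α) α :=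
  abs_le.1 ((abs_le_maxNorm A i j).trans h)

/-- The basic inequality: since the estimator does not increase the objective, the centred
processes at the error dominate half of the curvature of the expected objective. -/
theorem curvature_le_process [IsProbabilityMeasure μ] (hn : 1 ≤ (n₁ : ℝ) + n₂)
    (hmod : Model μ ds dm dθ P M Θ w x) (hbnd : Bounded M Θ αm αθ η)
    (hreg : LossRegular μ l M Θ x αm αl L) (hmom : MomentBound μ l M x αθ αl L η δ αδ)
    (hest : IsEstimator μ ds dm dθ αm αθ η l w x Mhat Θhat) :
    ∀ᵐ ω ∂μ, (∀ i j, |deriv (l i j (x i j ω)) (M i j)| ≤ αδ * Real.sqrt ((n₁ : ℝ) + n₂)) →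
      ((n₁ : ℝ) + n₂) ^ (-(δ / 2)) ≤ frob (err Mhat Θhat M Θ ω) →
      αh αθ η αl / 2 * frob (err Mhat Θhat M Θ ω) ^ 2 ≤
        ∑ p : Fin n₁ × Fin n₂, (truncIncr (l p.1 p.2) (M p.1 p.2)
            (αδ * Real.sqrt ((n₁ : ℝ) + n₂)) η (w p.1 p.2 ω, x p.1 p.2 ω)
              ((Mhat ω - M) p.1 p.2) -
          ∫ ω', truncIncr (l p.1 p.2) (M p.1 p.2)
            (αδ * Real.sqrt ((n₁ : ℝ) + n₂)) η (w p.1 p.2 ω', x p.1 p.2 ω')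
              ((Mhat ω - M) p.1 p.2) ∂μ) +
        ∑ p : Fin n₁ × Fin n₂, (w p.1 p.2 ω * (Θhat ω - Θ) p.1 p.2 -
          ∫ ω', w p.1 p.2 ω' * (Θhat ω - Θ) p.1 p.2 ∂μ) := by
  set N : ℝ := (n₁ : ℝ) + n₂ with hNdef
  set τ := αδ * Real.sqrt N with hτ
  have hN0 : 0 < N := by linarith
  have hlip' : ∀ i j, ∀ᵐ ω ∂μ, ∀ m ∈ Set.Icc (-αm) αm, ∀ m' ∈ Set.Icc (-αm) αm,
      |deriv (l i j (x i j ω)) m - deriv (l i j (x i j ω)) m'| ≤ L * |m - m'| := fun i j => by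
    filter_upwards [hreg.lipschitz] with ω hω using hω i j
  filter_upwards [hest.minimizes] with ω hmin htr hF
  obtain ⟨⟨-, hMb, hΘb⟩, hle⟩ := hmin
  have hle' := hle M Θ ⟨hmod.form, hbnd.bound_M, hbnd.bound_Θ⟩
  rw [← sub_nonpos, negLogLik_sub] at hle'
  set s : Fin n₁ × Fin n₂ → ℝ := fun p => (Mhat ω - M) p.1 p.2 with hs
  set u : Fin n₁ × Fin n₂ → ℝ := fun p => (Θhat ω - Θ) p.1 p.2 with hu
  set F := frob (err Mhat Θhat M Θ ω) with hFdef
  have hF2 : F ^ 2 = ∑ p, s p ^ 2 + ∑ p, u p ^ 2 := by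
    rw [hFdef, err_eq_fromRows, frob_fromRows_sq]
  set k := Real.exp αθ / (2 * (1 + Real.exp αθ) ^ 2) with hk
  set bias : Fin n₁ × Fin n₂ → ℝ := fun p =>
    η * (αδ * N ^ (-((4 + δ - 1) / 2)) * |s p| + L * N ^ (-((4 + δ) / 2)) * s p ^ 2) with hbias
  set T : Fin n₁ × Fin n₂ → Ω → ℝ := fun p ω' =>
    truncIncr (l p.1 p.2) (M p.1 p.2) τ η (w p.1 p.2 ω', x p.1 p.2 ω') (s p) with hT
  have hbias_sum : ∑ p, bias p ≤ αh αθ η αl / 2 * F ^ 2 := by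
    have h1 : ∑ p, bias p = η * (αδ * N ^ (-((4 + δ - 1) / 2)) * ∑ p, |s p| +
        L * N ^ (-((4 + δ) / 2)) * ∑ p, s p ^ 2) := by
      simp only [hbias]
      rw [← Finset.mul_sum, Finset.sum_add_distrib, ← Finset.mul_sum, ← Finset.mul_sum]
    rw [h1]
    have hu2 : 0 ≤ ∑ p, u p ^ 2 := Finset.sum_nonneg fun _ _ => sq_nonneg _
    refine bias_le_half_curvature (n₁ := n₁) (n₂ := n₂) hn hbnd.weight_pos hmom.pos_αδ
      hmom.pos_δ hreg.pos_L hmom.constants hF ?_ (by linarith)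
    refine (sum_abs_le_sqrt_mul s).trans ?_
    have hc : ((Fintype.card (Fin n₁ × Fin n₂) : ℕ) : ℝ) = n₁ * n₂ := by simp
    rw [hc]
    refine mul_le_mul_of_nonneg_left ?_ (Real.sqrt_nonneg _)
    exact (Real.sqrt_le_left (frob_nonneg _)).2 (by linarith)
  have hET : ∀ p, ∫ ω', T p ω' ∂μ ≤ -(η * αl * s p ^ 2) + bias p := by
    intro p
    have hmM := mem_Icc_of_maxNorm_le hbnd.bound_M p.1 p.2
    have hmH : M p.1 p.2 + s p ∈ Set.Icc (-αm) αm := by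
      have : M p.1 p.2 + s p = Mhat ω p.1 p.2 := by simp [hs]
      rw [this]
      exact mem_Icc_of_maxNorm_le hMb p.1 p.2
    refine integral_truncIncr_le (q := 4 + δ) (hmod.measurable_w p.1 p.2)
      (hmod.measurable_x p.1 p.2) (hmod.indepFun p.1 p.2) (hmod.integral_w p.1 p.2)
      (Real.sigmoid_nonneg _) (Real.sigmoid_le_one _) (hreg.measurable_l p.1 p.2)
      (hreg.differentiable_l p.1 p.2) hbnd.weight_pos.le hreg.pos_L.le hmom.pos_αδ hN0
      (by linarith [hmom.pos_δ]) (hlip' p.1 p.2) (hreg.integrable_l p.1 p.2) hmM hmH ?_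
      (hmom.moment p.1 p.2)
    have := hreg.excess p.1 p.2 _ hmH
    rwa [add_sub_cancel_left] at this
  have hEw : ∀ p : Fin n₁ × Fin n₂, ∫ ω', w p.1 p.2 ω' * u p ∂μ =
      Real.sigmoid (Θ p.1 p.2) * u p := by
    intro p
    rw [integral_mul_const, hmod.integral_w]
  have hterm : ∀ p : Fin n₁ × Fin n₂,
      αh αθ η αl * (s p ^ 2 + u p ^ 2) - bias p ≤
        (T p ω - ∫ ω', T p ω' ∂μ) + (w p.1 p.2 ω * u p - ∫ ω', w p.1 p.2 ω' * u p ∂μ) +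
        (w p.1 p.2 ω * (η * (l p.1 p.2 (x p.1 p.2 ω) (M p.1 p.2) -
          l p.1 p.2 (x p.1 p.2 ω) (Mhat ω p.1 p.2))) +
          w p.1 p.2 ω * (Θ p.1 p.2 - Θhat ω p.1 p.2) +
        (Real.log (1 - Real.sigmoid (Θ p.1 p.2)) -
          Real.log (1 - Real.sigmoid (Θhat ω p.1 p.2)))) := by
    intro p
    have h1 : T p ω = w p.1 p.2 ω * (η * (l p.1 p.2 (x p.1 p.2 ω) (Mhat ω p.1 p.2) -
        l p.1 p.2 (x p.1 p.2 ω) (M p.1 p.2))) := by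
      have e : M p.1 p.2 + s p = Mhat ω p.1 p.2 := by simp [hs]
      simp only [hT, truncIncr, if_pos (htr p.1 p.2), e]
    have h2 := log_one_sub_sigmoid_curvature ((abs_le_maxNorm Θ p.1 p.2).trans hbnd.bound_Θ)
      ((abs_le_maxNorm (Θhat ω) p.1 p.2).trans hΘb)
    have h3 : Θhat ω p.1 p.2 - Θ p.1 p.2 = u p := by simp [hu]
    rw [← hk, h3] at h2
    have h4 := hET p
    have h5 : αh αθ η αl * s p ^ 2 ≤ η * αl * s p ^ 2 :=
      mul_le_mul_of_nonneg_right (min_le_right _ _) (sq_nonneg _)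
    have h6 : αh αθ η αl * u p ^ 2 ≤ k * u p ^ 2 :=
      mul_le_mul_of_nonneg_right (min_le_left _ _) (sq_nonneg _)
    rw [h1, hEw p]
    have h7 : w p.1 p.2 ω * (Θ p.1 p.2 - Θhat ω p.1 p.2) = -(w p.1 p.2 ω * u p) := by
      rw [← h3]; ring
    rw [h7]
    linarith
  have hsum := Finset.sum_le_sum fun p (_ : p ∈ Finset.univ) => hterm p
  rw [Finset.sum_sub_distrib, ← Finset.mul_sum, Finset.sum_add_distrib, ← hF2,
    Finset.sum_add_distrib, Finset.sum_add_distrib] at hsum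
  linarith

/-- The probability that some derivative at the truth exceeds the truncation level. -/
theorem measureReal_exists_not_truncated_le [IsProbabilityMeasure μ] (hn : 0 < (n₁ : ℝ) + n₂)
    (hmod : Model μ ds dm dθ P M Θ w x) (hreg : LossRegular μ l M Θ x αm αl L)
    (hmom : MomentBound μ l M x αθ αl L η δ αδ) :
    μ.real {ω | ¬ ∀ i j, |deriv (l i j (x i j ω)) (M i j)| ≤
      αδ * Real.sqrt ((n₁ : ℝ) + n₂)} ≤
      (n₁ : ℝ) * n₂ / ((n₁ : ℝ) + n₂) ^ (2 + δ / 2) := by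
  have hsub : {ω | ¬ ∀ i j, |deriv (l i j (x i j ω)) (M i j)| ≤
      αδ * Real.sqrt ((n₁ : ℝ) + n₂)} ⊆ ⋃ p : Fin n₁ × Fin n₂,
      {ω | ¬ |deriv (l p.1 p.2 (x p.1 p.2 ω)) (M p.1 p.2)| ≤
        αδ * Real.sqrt ((n₁ : ℝ) + n₂)} := by
    intro ω hω
    obtain ⟨i, hi⟩ := not_forall.1 hω
    obtain ⟨j, hj⟩ := not_forall.1 hi
    exact Set.mem_iUnion.2 ⟨(i, j), hj⟩
  refine (measureReal_mono hsub).trans ((measureReal_iUnion_fintype_le _).trans ?_)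
  calc _ ≤ ∑ _p : Fin n₁ × Fin n₂, ((n₁ : ℝ) + n₂) ^ (-((4 + δ) / 2)) := by
        refine Finset.sum_le_sum fun p _ => ?_
        refine measureReal_truncation_le (μ := μ)
          (g := fun ω => deriv (l p.1 p.2 (x p.1 p.2 ω)) (M p.1 p.2))
          ((measurable_deriv_of_measurable_family (hreg.measurable_l p.1 p.2)
            (hreg.differentiable_l p.1 p.2) _).comp (hmod.measurable_x p.1 p.2))
          hmom.pos_αδ hn (by linarith [hmom.pos_δ]) (hmom.moment p.1 p.2)
    _ = _ := by
        have e : -((4 + δ) / 2) = -(2 + δ / 2) := by ring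
        rw [Finset.sum_const, nsmul_eq_mul, e, Real.rpow_neg hn.le, ← div_eq_mul_inv]
        simp only [Finset.card_univ, Fintype.card_prod, Fintype.card_fin, Nat.cast_mul]

end ModelFacts

/-! ### Dyadic shells of the error -/

/-- With the largest step `c` allowed by the bound `A` of the Lipschitz constants, the variance term
of the exponential moment is at most `N`, of the same order as the entropy term. -/
theorem tail_constant_le {N m n r b A κ c : ℝ} (hN : 1 ≤ N) (hm : 0 ≤ m) (hn : 0 ≤ n)
    (hmn : m + n = N) (hr : 0 < r) (hb : 0 < b) (hκ : 0 < κ) (hA : A = Real.sqrt N * κ)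
    (hc : c = 1 / (2 * r * b * A)) :
    4 * (c * (r * b)) ^ 2 * κ ^ 2 * (m * n) ≤ N := by
  have hA0 : 0 < A := by rw [hA]; have := Real.sqrt_pos.2 (show 0 < N by linarith); positivity
  have e1 : c * (r * b) = 1 / (2 * A) := by rw [hc]; field_simp
  have e2 : A ^ 2 = N * κ ^ 2 := by rw [hA, mul_pow, Real.sq_sqrt (by linarith)]
  have e3 : 4 * (c * (r * b)) ^ 2 * κ ^ 2 * (m * n) = m * n / N := by
    rw [e1, div_pow, mul_pow, e2]
    field_simp
    ring
  rw [e3, div_le_iff₀ (by linarith), ← hmn]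
  nlinarith

theorem err_inl_apply {n₁ n₂ : ℕ} {Ω : Type*}
    (Mhat Θhat : Ω → Matrix (Fin n₁) (Fin n₂) ℝ) (M Θ : Matrix (Fin n₁) (Fin n₂) ℝ) (ω : Ω)
    (i : Fin n₁) (j : Fin n₂) :
    err Mhat Θhat M Θ ω (Sum.inl i) j = (Mhat ω - M) i j := by
  rw [err_eq_fromRows]; rfl

theorem err_inr_apply {n₁ n₂ : ℕ} {Ω : Type*}
    (Mhat Θhat : Ω → Matrix (Fin n₁) (Fin n₂) ℝ) (M Θ : Matrix (Fin n₁) (Fin n₂) ℝ) (ω : Ω)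
    (i : Fin n₁) (j : Fin n₂) :
    err Mhat Θhat M Θ ω (Sum.inr i) j = (Θhat ω - Θ) i j := by
  rw [err_eq_fromRows]; rfl

theorem αh_pos {αθ η αl : ℝ} (hη : 0 < η) (hαl : 0 < αl) : 0 < αh αθ η αl := by
  have := Real.exp_pos αθ
  exact lt_min (by positivity) (by positivity)

theorem one_le_cδ {η αδ L αm : ℝ} : 1 ≤ cδ η αδ L αm := le_max_right _ _

section Shells

variable {n₁ n₂ ds dm dθ : ℕ} {Ω : Type*} [MeasurableSpace Ω] {μ : Measure Ω}
  [IsProbabilityMeasure μ] {P : Fin n₁ → Fin n₂ → ℝ → Measure ℝ}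
  {M Θ : Matrix (Fin n₁) (Fin n₂) ℝ} {w x : Fin n₁ → Fin n₂ → Ω → ℝ}
  {l : Fin n₁ → Fin n₂ → ℝ → ℝ → ℝ} {αm αθ η αl L δ αδ : ℝ}
  {Mhat Θhat : Ω → Matrix (Fin n₁) (Fin n₂) ℝ}

/-- The tail bound for either of the two centred processes over matrices of rank at most `2 * d`
with entries at most `s / (c * N)`, at a level of the order `s ^ 2` of the curvature. The
random Lipschitz constants are at most `√N * κ`. -/
theorem measure_process_shell_le {X : Type*} [MeasurableSpace X] {d : ℕ} (hd : 0 < d)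
    {c s κ a₀ N : ℝ} (hN : 1 ≤ N) (hNn : N = (n₁ : ℝ) + n₂) (hc : 0 < c) (hs : 0 < s)
    (hκ : 0 < κ) (ha₀ : 0 < a₀)
    (ξ : Fin n₁ × Fin n₂ → Ω → X) (hξ : ∀ p, Measurable (ξ p)) (hind : iIndepFun ξ μ)
    (f : Fin n₁ × Fin n₂ → X → ℝ → ℝ) (a : Fin n₁ × Fin n₂ → X → ℝ)
    (S : Fin n₁ × Fin n₂ → Set ℝ)
    (hf : ∀ p s, Measurable fun x => f p x s) (ha : ∀ p, Measurable (a p))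
    (hbd : ∀ᵐ ω ∂μ, ∀ p, 0 ≤ a p (ξ p ω) ∧ a p (ξ p ω) ≤ Real.sqrt N * κ ∧
      ∀ s ∈ S p, ∀ s' ∈ S p,
      |f p (ξ p ω) s - f p (ξ p ω) s'| ≤ a p (ξ p ω) * |s - s'|)
    (hf0 : ∀ p x, f p x 0 = 0) (hS0 : ∀ p, 0 ∈ S p)
    (hκ2 : ∀ p, ∫⁻ ω, ENNReal.ofReal (a p (ξ p ω) ^ 2) ∂μ ≤ ENNReal.ofReal (κ ^ 2)) :
    μ {ω | ∃ D : Matrix (Fin n₁) (Fin n₂) ℝ, (D.rank ≤ 2 * d ∧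
        ∀ i j, |D i j| ≤ s / (c * N) ∧ D i j ∈ S (i, j)) ∧
        a₀ * s ^ 2 / 16 ≤
          ∑ p, (f p (ξ p ω) (D p.1 p.2) - ∫ ω', f p (ξ p ω') (D p.1 p.2) ∂μ)} ≤
      ENNReal.ofReal (Real.exp (2 * N - a₀ * c * Real.sqrt N * s / (128 * d * κ))) := by
  have hN0 : 0 < N := by linarith
  have hsq : 0 < Real.sqrt N := Real.sqrt_pos.2 hN0
  have hd' : (0 : ℝ) < d := Nat.cast_pos.2 hd
  set b := s / (c * N) with hb
  have hb0 : 0 < b := by positivity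
  set A := Real.sqrt N * κ with hA
  have hA0 : 0 < A := by positivity
  set r : ℕ := 2 * d with hr
  have hr' : (0 : ℝ) < r := Nat.cast_pos.2 (by omega)
  set lam := 1 / (2 * r * b * A) with hlam
  have hlam0 : 0 < lam := by positivity
  refine (measure_process_ge_le μ (r := r) (by omega) (b := b) (A := A) (κ := κ) (c := lam)
    (u := a₀ * s ^ 2 / 16) hb0.le hA0.le hlam0 (by positivity) ξ hξ hind f a S hf ha hbd hf0 hS0
    hκ2 (le_of_eq (by rw [hlam]; field_simp))
    {D | D.rank ≤ r ∧ ∀ i j, |D i j| ≤ b ∧ D i j ∈ S (i, j)} (fun D hD => hD)).trans ?_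
  refine ENNReal.ofReal_le_ofReal ?_
  have h1 := tail_constant_le hN (Nat.cast_nonneg n₁) (Nat.cast_nonneg n₂) hNn.symm hr' hb0
    hκ hA hlam
  have h2 : (2 : ℝ) ^ (n₁ + n₂) ≤ Real.exp N := by
    have : (2 : ℝ) ≤ Real.exp 1 := by linarith [Real.add_one_le_exp (1 : ℝ)]
    calc (2 : ℝ) ^ (n₁ + n₂) ≤ Real.exp 1 ^ (n₁ + n₂) := pow_le_pow_left₀ (by norm_num) this _
      _ = Real.exp N := by rw [← Real.exp_nat_mul, hNn]; push_cast; ring_nf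
  have h3 : lam * (a₀ * s ^ 2 / 16 / 2) = a₀ * c * Real.sqrt N * s / (128 * d * κ) := by
    have hNN : N = Real.sqrt N * Real.sqrt N := (Real.mul_self_sqrt hN0.le).symm
    rw [hlam, hb, hA, hr]
    push_cast
    rw [div_mul_eq_mul_div, one_mul, div_eq_div_iff (by positivity) (by positivity)]
    field_simp
    nlinarith
  calc _ ≤ Real.exp N * Real.exp N * Real.exp (-(lam * (a₀ * s ^ 2 / 16 / 2))) := by
        gcongr
    _ = _ := by rw [h3, ← Real.exp_add, ← Real.exp_add]; congr 1; ring

/-- The probability that the error lies in a dyadic shell of Frobenius norms while its entries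
are flat at scale `c`. -/
theorem measure_shell_le (hn : 1 ≤ (n₁ : ℝ) + n₂) (hd : 0 < ds + dm + dθ)
    (hmod : Model μ ds dm dθ P M Θ w x) (hbnd : Bounded M Θ αm αθ η)
    (hreg : LossRegular μ l M Θ x αm αl L) (hmom : MomentBound μ l M x αθ αl L η δ αδ)
    (hest : IsEstimator μ ds dm dθ αm αθ η l w x Mhat Θhat) {c s : ℝ} (hc : 0 < c)
    (hs : ((n₁ : ℝ) + n₂) ^ (-(δ / 2)) ≤ s / 2) :
    μ {ω | (∀ i j, |deriv (l i j (x i j ω)) (M i j)| ≤ αδ * Real.sqrt ((n₁ : ℝ) + n₂)) ∧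
        s / 2 ≤ frob (err Mhat Θhat M Θ ω) ∧ frob (err Mhat Θhat M Θ ω) ≤ s ∧
        c * ((n₁ : ℝ) + n₂) * maxNorm (err Mhat Θhat M Θ ω) ≤ frob (err Mhat Θhat M Θ ω)} ≤
      ENNReal.ofReal (2 * Real.exp (2 * ((n₁ : ℝ) + n₂) -
        αh αθ η αl * c * Real.sqrt ((n₁ : ℝ) + n₂) * s /
          (128 * (ds + dm + dθ : ℕ) * cδ η αδ L αm))) := by
  set N : ℝ := (n₁ : ℝ) + n₂ with hN
  set τ := αδ * Real.sqrt N with hτ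
  set K := cδ η αδ L αm with hK
  have hK1 : 1 ≤ K := one_le_cδ
  have hN0 : 0 < N := by linarith
  have hsq1 : 1 ≤ Real.sqrt N := Real.one_le_sqrt.2 hn
  have hη := hbnd.weight_pos
  have hαδ := hmom.pos_αδ
  have hL := hreg.pos_L
  have hαm : 0 ≤ αm := (maxNorm_nonneg M).trans hbnd.bound_M
  have hs0 : 0 < s := by linarith [Real.rpow_pos_of_pos hN0 (-(δ / 2))]
  have hah := αh_pos (αθ := αθ) hη hreg.pos_αl
  have hK2 : η * (αδ + 2 * L * αm) ≤ K := by
    refine le_trans (le_of_eq ?_) (le_max_left _ _)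
    ring
  let ξ : Fin n₁ × Fin n₂ → Ω → ℝ × ℝ := fun p ω => (w p.1 p.2 ω, x p.1 p.2 ω)
  have hξind : iIndepFun ξ μ := iIndepFun_prodMk_of_indepFun
    (w := fun p : Fin n₁ × Fin n₂ => w p.1 p.2) (x := fun p : Fin n₁ × Fin n₂ => x p.1 p.2)
    (fun p => hmod.measurable_w p.1 p.2) (fun p => hmod.measurable_x p.1 p.2) hmod.indep_w
    hmod.indep_x hmod.indep_w_x
  have hloss := measure_process_shell_le (μ := μ) (d := ds + dm + dθ) hd (s := s) (κ := K)
    (a₀ := αh αθ η αl) hn hN hc hs0 (by linarith) hah ξ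
    (fun p => (hmod.measurable_w p.1 p.2).prodMk (hmod.measurable_x p.1 p.2)) hξind
    (fun p => truncIncr (l p.1 p.2) (M p.1 p.2) τ η)
    (fun p => truncLip (l p.1 p.2) (M p.1 p.2) τ η (2 * L * αm))
    (fun p => {s | M p.1 p.2 + s ∈ Set.Icc (-αm) αm})
    (fun p s => measurable_truncIncr (hreg.measurable_l p.1 p.2)
      (hreg.differentiable_l p.1 p.2) s)
    (fun p => measurable_truncLip (hreg.measurable_l p.1 p.2) (hreg.differentiable_l p.1 p.2))
    (by
      filter_upwards [hmod.ae_abs_w_le_one, hreg.lipschitz] with ω h1 h2 p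
      refine ⟨truncLip_nonneg hη.le (by positivity) _, ?_, fun s hs s' hs' => ?_⟩
      · refine (truncLip_le hη.le (by positivity) _).trans ?_
        calc η * (τ + 2 * L * αm) ≤ η * (αδ * Real.sqrt N + Real.sqrt N * (2 * L * αm)) := by
              rw [hτ]
              have : 2 * L * αm ≤ Real.sqrt N * (2 * L * αm) :=
                le_mul_of_one_le_left (by positivity) hsq1
              gcongr
          _ = Real.sqrt N * (η * (αδ + 2 * L * αm)) := by ring
          _ ≤ Real.sqrt N * K := by gcongr
      · exact abs_truncIncr_sub_le (hreg.differentiable_l p.1 p.2) hη.le hL.le (h1 p.1 p.2)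
          (h2 p.1 p.2) (mem_Icc_of_maxNorm_le hbnd.bound_M p.1 p.2) hs hs')
    (fun p z => by simp [truncIncr])
    (fun p => by simpa using mem_Icc_of_maxNorm_le hbnd.bound_M p.1 p.2)
    (fun p => by
      refine le_trans (lintegral_mono fun ω => ENNReal.ofReal_le_ofReal (pow_le_pow_left₀
        (truncLip_nonneg hη.le (by positivity) _) (truncLip_le_abs_deriv hη.le _) 2)) ?_
      refine (lintegral_scaled_shifted_sq_le (q := 4 + δ)
        ((measurable_deriv_of_measurable_family (hreg.measurable_l p.1 p.2)
          (hreg.differentiable_l p.1 p.2) _).comp (hmod.measurable_x p.1 p.2)) hαδ.le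
        (by positivity) (by linarith [hmom.pos_δ]) (hmom.moment p.1 p.2)).trans ?_
      exact ENNReal.ofReal_le_ofReal (pow_le_pow_left₀ (by positivity) hK2 2))
  have hlin := measure_process_shell_le (μ := μ) (d := ds + dm + dθ) hd (s := s) (κ := K)
    (a₀ := αh αθ η αl) hn hN hc hs0 (by linarith) hah (fun p ω => w p.1 p.2 ω)
    (fun p => hmod.measurable_w p.1 p.2) hmod.indep_w
    (fun _ y s => y * s) (fun _ _ => 1) (fun _ => Set.univ)
    (fun p s => measurable_id.mul_const s) (fun p => measurable_const)
    (by
      filter_upwards [hmod.ae_abs_w_le_one] with ω h1 p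
      refine ⟨zero_le_one, ?_, fun s _ s' _ => ?_⟩
      · nlinarith
      · rw [← mul_sub, abs_mul]
        exact mul_le_mul_of_nonneg_right (h1 p.1 p.2) (abs_nonneg _))
    (fun p y => mul_zero y) (fun p => Set.mem_univ _)
    (fun p => by
      rw [lintegral_const, measure_univ, mul_one]
      exact ENNReal.ofReal_le_ofReal (pow_le_pow_left₀ zero_le_one hK1 2))
  rw [two_mul (Real.exp _), ENNReal.ofReal_add (Real.exp_pos _).le (Real.exp_pos _).le]
  refine le_trans ?_ (add_le_add hloss hlin)
  refine le_trans (measure_mono_ae ?_) (measure_union_le _ _)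
  filter_upwards [hest.minimizes, curvature_le_process hn hmod hbnd hreg hmom hest]
    with ω hmin hcurv
  rintro ⟨htr, hF1, hF2, hflat⟩
  have hbasic := hcurv htr (hs.trans hF1)
  obtain ⟨⟨hform, hMb, -⟩, -⟩ := hmin
  obtain ⟨hr1, hr2⟩ := rank_sub_le_of_hasSharedFactorForm hform hmod.form
  have hmax : maxNorm (err Mhat Θhat M Θ ω) ≤ s / (c * N) := by
    rw [le_div_iff₀ (by positivity), mul_comm]
    exact hflat.trans hF2
  have hF3 : s ^ 2 / 4 ≤ frob (err Mhat Θhat M Θ ω) ^ 2 := by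
    have := pow_le_pow_left₀ (by positivity) hF1 2
    linarith [show (s / 2) ^ 2 = s ^ 2 / 4 by ring]
  have hF4 := mul_le_mul_of_nonneg_left hF3 hah.le
  -- the two sums reach `αh * s ^ 2 / 8` together, so one of them reaches half of it
  by_cases hcase : αh αθ η αl * s ^ 2 / 16 ≤
      ∑ p : Fin n₁ × Fin n₂, (truncIncr (l p.1 p.2) (M p.1 p.2) τ η (ξ p ω)
        ((Mhat ω - M) p.1 p.2) - ∫ ω', truncIncr (l p.1 p.2) (M p.1 p.2) τ η (ξ p ω')
          ((Mhat ω - M) p.1 p.2) ∂μ)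
  · refine Or.inl ⟨Mhat ω - M, ⟨hr1, fun i j => ⟨?_, ?_⟩⟩, hcase⟩
    · rw [← err_inl_apply Mhat Θhat M Θ]
      exact (abs_le_maxNorm _ _ _).trans hmax
    · have : M i j + (Mhat ω - M) i j = Mhat ω i j := by simp
      change M i j + (Mhat ω - M) i j ∈ Set.Icc (-αm) αm
      rw [this]
      exact mem_Icc_of_maxNorm_le hMb i j
  · refine Or.inr ⟨Θhat ω - Θ, ⟨hr2, fun i j => ⟨?_, Set.mem_univ _⟩⟩, ?_⟩
    · rw [← err_inr_apply Mhat Θhat M Θ]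
      exact (abs_le_maxNorm _ _ _).trans hmax
    · have := not_le.1 hcase
      linarith

end Shells

/-! ### Summation over shells and over the flatness ratio -/

theorem tsum_ofReal_geometric_le {C y : ℝ} (hC : 0 ≤ C) (hy0 : 0 ≤ y) (hy1 : y < 1) :
    ∑' k : ℕ, ENNReal.ofReal (C * y ^ k) ≤ ENNReal.ofReal (C / (1 - y)) := by
  have hs : Summable fun k : ℕ => C * y ^ k := (summable_geometric_of_lt_one hy0 hy1).mul_left C
  rw [← ENNReal.ofReal_tsum_of_nonneg (fun k => by positivity) hs, tsum_mul_left,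
    tsum_geometric_of_lt_one hy0 hy1, div_eq_mul_inv]

section Tail

variable {n₁ n₂ ds dm dθ : ℕ} {Ω : Type*} [MeasurableSpace Ω] {μ : Measure Ω}
  [IsProbabilityMeasure μ] {P : Fin n₁ → Fin n₂ → ℝ → Measure ℝ}
  {M Θ : Matrix (Fin n₁) (Fin n₂) ℝ} {w x : Fin n₁ → Fin n₂ → Ω → ℝ}
  {l : Fin n₁ → Fin n₂ → ℝ → ℝ → ℝ} {αm αθ η αl L δ αδ : ℝ}
  {Mhat Θhat : Ω → Matrix (Fin n₁) (Fin n₂) ℝ}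

/-- The tail bound for the error on the event that no derivative is truncated and the error is
flat at scale `c`, by summation over dyadic shells. -/
theorem measure_flat_le (hn : 1 ≤ (n₁ : ℝ) + n₂) (hd : 0 < ds + dm + dθ)
    (hmod : Model μ ds dm dθ P M Θ w x) (hbnd : Bounded M Θ αm αθ η)
    (hreg : LossRegular μ l M Θ x αm αl L) (hmom : MomentBound μ l M x αθ αl L η δ αδ)
    (hest : IsEstimator μ ds dm dθ αm αθ η l w x Mhat Θhat) {c t : ℝ} (hc : 0 < c)
    (ht : ((n₁ : ℝ) + n₂) ^ (-(δ / 2)) < t) :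
    μ {ω | (∀ i j, |deriv (l i j (x i j ω)) (M i j)| ≤ αδ * Real.sqrt ((n₁ : ℝ) + n₂)) ∧
        t ≤ frob (err Mhat Θhat M Θ ω) ∧
        c * ((n₁ : ℝ) + n₂) * maxNorm (err Mhat Θhat M Θ ω) ≤ frob (err Mhat Θhat M Θ ω)} ≤
      ENNReal.ofReal (8 * Real.exp (-(1 / 128 * (αh αθ η αl * c /
        (cδ η αδ L αm * ((ds + dm + dθ : ℕ) : ℝ) ^ (3 / 2 : ℝ)
          * ((n₁ : ℝ) + n₂) ^ (1 / 2 : ℝ)) * t)))) := by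
  set N : ℝ := (n₁ : ℝ) + n₂ with hN
  set K := cδ η αδ L αm with hK
  set d : ℝ := ((ds + dm + dθ : ℕ) : ℝ) with hd'
  have hd1 : 1 ≤ d := by rw [hd']; exact_mod_cast hd
  have hd0 : 0 < d := by linarith
  have hK0 : 0 < K := by linarith [one_le_cδ (η := η) (αδ := αδ) (L := L) (αm := αm)]
  have hN0 : 0 < N := by linarith
  have ht0 : 0 < t := (Real.rpow_pos_of_pos hN0 _).trans ht
  have hah := αh_pos (αθ := αθ) hbnd.weight_pos hreg.pos_αl
  have hsN : 0 < Real.sqrt N := Real.sqrt_pos.2 hN0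
  have hsd : 1 ≤ Real.sqrt d := Real.one_le_sqrt.2 hd1
  have hNh : N ^ (1 / 2 : ℝ) = Real.sqrt N := (Real.sqrt_eq_rpow N).symm
  have hdh : d ^ (3 / 2 : ℝ) = d * Real.sqrt d := by
    rw [Real.sqrt_eq_rpow, ← Real.rpow_one_add' hd0.le (by norm_num)]; norm_num
  rw [hNh, hdh]
  set q := αh αθ η αl * c / (K * (d * Real.sqrt d) * Real.sqrt N) * t with hq
  have hq0 : 0 < q := by positivity
  rcases lt_or_ge q 256 with hsmall | hlarge
  · -- here the bound exceeds `1`, since `8 > exp 2`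
    refine prob_le_one.trans ?_
    rw [← ENNReal.ofReal_one]
    refine ENNReal.ofReal_le_ofReal ?_
    have h1 : Real.exp (-2) ≤ Real.exp (-(1 / 128 * q)) := Real.exp_le_exp.2 (by linarith)
    have h2 : Real.exp 2 ≤ 8 := by
      have h3 := Real.exp_one_lt_d9
      have : Real.exp 2 = Real.exp 1 * Real.exp 1 := by rw [← Real.exp_add]; norm_num
      rw [this]
      nlinarith [Real.exp_pos 1]
    have h3 : Real.exp 2 * Real.exp (-2) = 1 := by rw [← Real.exp_add]; norm_num
    nlinarith [Real.exp_pos (-2)]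
  · -- the entropy `2 * N` of a shell is absorbed by its exponent because `q ≥ 256`
    set y := Real.exp (-(1 / 128 * q)) with hy
    have hy0 : 0 < y := Real.exp_pos _
    have hy2 : y ≤ 1 / 2 := by
      have h1 : y ≤ Real.exp (-1) := Real.exp_le_exp.2 (by linarith)
      have h2 : Real.exp 1 * Real.exp (-1) = 1 := by rw [← Real.exp_add]; norm_num
      have h3 := Real.add_one_le_exp (1 : ℝ)
      nlinarith [Real.exp_pos (-1)]
    have hshell : ∀ k : ℕ, μ {ω |
        (∀ i j, |deriv (l i j (x i j ω)) (M i j)| ≤ αδ * Real.sqrt N) ∧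
        t * 2 ^ (k + 1) / 2 ≤ frob (err Mhat Θhat M Θ ω) ∧
        frob (err Mhat Θhat M Θ ω) ≤ t * 2 ^ (k + 1) ∧
        c * N * maxNorm (err Mhat Θhat M Θ ω) ≤ frob (err Mhat Θhat M Θ ω)} ≤
        ENNReal.ofReal (2 * y * y ^ k) := by
      intro k
      have hp1 : (1 : ℝ) ≤ 2 ^ k := one_le_pow₀ (by norm_num)
      refine (measure_shell_le hn hd hmod hbnd hreg hmom hest hc ?_).trans ?_
      · rw [pow_succ]; nlinarith
      refine ENNReal.ofReal_le_ofReal ?_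
      rw [mul_assoc 2 y, ← pow_succ', hy, ← Real.exp_nat_mul]
      refine mul_le_mul_of_nonneg_left (Real.exp_le_exp.2 ?_) (by norm_num)
      have hexp : q * N * 2 ^ (k + 1) / 128 ≤
          αh αθ η αl * c * Real.sqrt N * (t * 2 ^ (k + 1)) / (128 * d * K) := by
        have e : q * N * 2 ^ (k + 1) / 128 =
            αh αθ η αl * c * Real.sqrt N * (t * 2 ^ (k + 1)) / (128 * d * K) / Real.sqrt d := by
          have hNN : N = Real.sqrt N * Real.sqrt N := (Real.mul_self_sqrt hN0.le).symm
          rw [hq]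
          nth_rewrite 2 [hNN]
          field_simp
        rw [e]
        exact div_le_self (by positivity) hsd
      have hk : ((k : ℝ) + 2) ≤ 2 ^ (k + 1) := by
        have := Nat.lt_two_pow_self (n := k + 1)
        exact_mod_cast this
      have hqN : q ≤ q * N := le_mul_of_one_le_right hq0.le hn
      have h5 : q * ((k : ℝ) + 1) ≤ q * N * (2 ^ (k + 1) - 1) :=
        mul_le_mul hqN (by linarith) (by positivity) (by positivity)
      have h6 : 2 * N ≤ q * N / 128 := by nlinarith
      have h7 : ((k + 1 : ℕ) : ℝ) * -(1 / 128 * q) = -(q * ((k : ℝ) + 1)) / 128 := by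
        rw [Nat.cast_add_one]; ring
      rw [h7, ← hN, ← hK, ← hd']
      linarith
    calc _ ≤ μ (⋃ k : ℕ, {ω |
        (∀ i j, |deriv (l i j (x i j ω)) (M i j)| ≤ αδ * Real.sqrt N) ∧
        t * 2 ^ (k + 1) / 2 ≤ frob (err Mhat Θhat M Θ ω) ∧
        frob (err Mhat Θhat M Θ ω) ≤ t * 2 ^ (k + 1) ∧
        c * N * maxNorm (err Mhat Θhat M Θ ω) ≤ frob (err Mhat Θhat M Θ ω)}) := by
          refine measure_mono ?_
          rintro ω ⟨h1, h2, h3⟩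
          obtain ⟨k, hk1, hk2⟩ := exists_nat_pow_near (x := frob (err Mhat Θhat M Θ ω) / t)
            (y := 2) ((one_le_div ht0).2 h2) (by norm_num)
          rw [le_div_iff₀ ht0] at hk1
          rw [div_lt_iff₀ ht0] at hk2
          refine Set.mem_iUnion.2 ⟨k, h1, ?_, by linarith, h3⟩
          rw [pow_succ]; linarith
      _ ≤ ∑' k : ℕ, ENNReal.ofReal (2 * y * y ^ k) :=
          (measure_iUnion_le _).trans (ENNReal.tsum_le_tsum hshell)
      _ ≤ ENNReal.ofReal (2 * y / (1 - y)) :=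
          tsum_ofReal_geometric_le (by positivity) hy0.le (by linarith)
      _ ≤ _ := by
          refine ENNReal.ofReal_le_ofReal ?_
          rw [div_le_iff₀ (by linarith)]
          nlinarith

/-- The flatness ratio `‖Δ‖_F / (N ‖Δ‖_∞)` is at most `1`; on each of its dyadic ranges the
weighted error being large forces `‖Δ‖_F` to be large by the matching power of two. -/
theorem exists_dyadic_of_le_weighted {N F X c t : ℝ} (hN : 0 < N) (hX : 0 < X) (hF : 0 < F)
    (hFX : F ≤ N * X) (hc : 0 < c)
    (h : t ≤ F ^ (2 + c) / (N ^ (1 + c) * X ^ (1 + c))) :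
    ∃ k : ℕ, t * (2 ^ k : ℝ) ^ (1 + c) ≤ F ∧ (1 / 2 : ℝ) ^ (k + 1) * N * X ≤ F := by
  set R := F / (N * X) with hR
  have hR0 : 0 < R := by positivity
  have hR1 : R ≤ 1 := (div_le_one (by positivity)).2 hFX
  have hV : F ^ (2 + c) / (N ^ (1 + c) * X ^ (1 + c)) = F * R ^ (1 + c) := by
    rw [hR, Real.div_rpow hF.le (by positivity), Real.mul_rpow hN.le hX.le,
      show (2 + c : ℝ) = 1 + (1 + c) by ring, Real.rpow_add hF, Real.rpow_one, mul_div_assoc]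
  rw [hV] at h
  obtain ⟨k, hk1, hk2⟩ := exists_nat_pow_near (x := R⁻¹) (y := 2) ((one_le_inv₀ hR0).2 hR1)
    (by norm_num)
  refine ⟨k, ?_, ?_⟩
  · have hk3 : (2 : ℝ) ^ k * R ≤ 1 := by
      calc (2 : ℝ) ^ k * R ≤ R⁻¹ * R := by gcongr
        _ = 1 := inv_mul_cancel₀ hR0.ne'
    calc t * (2 ^ k : ℝ) ^ (1 + c) ≤ F * R ^ (1 + c) * (2 ^ k : ℝ) ^ (1 + c) := by gcongr
      _ = F * (2 ^ k * R) ^ (1 + c) := by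
          rw [Real.mul_rpow (by positivity) hR0.le]; ring
      _ ≤ F * 1 := by
          gcongr
          exact Real.rpow_le_one (by positivity) hk3 (by linarith)
      _ = F := mul_one F
  · have hk4 : (1 / 2 : ℝ) ^ (k + 1) ≤ R := by
      rw [one_div, inv_pow]
      exact inv_le_of_inv_le₀ hR0 hk2.le
    calc (1 / 2 : ℝ) ^ (k + 1) * N * X ≤ R * N * X := by gcongr
      _ = F := by rw [hR]; field_simp

theorem two_pow_rpow_lower (k : ℕ) {c : ℝ} (hc : 0 < c) :
    1 + k * (c / 2) ≤ ((2 : ℝ) ^ k) ^ c := by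
  have h1 : ((2 : ℝ) ^ k) ^ c = Real.exp (k * c * Real.log 2) := by
    rw [← Real.rpow_natCast, ← Real.rpow_mul (by norm_num), Real.rpow_def_of_pos (by norm_num)]
    ring_nf
  have h2 := Real.log_two_gt_d9
  have h3 := Real.add_one_le_exp ((k : ℝ) * c * Real.log 2)
  rw [h1]
  have h4 : (k : ℝ) * c * (1 / 2) ≤ k * c * Real.log 2 := by
    gcongr
    linarith
  linarith

/-- The tail bound for the weighted error on the event that no derivative is truncated, by
summation over the dyadic ranges of the flatness ratio. -/
theorem measure_weighted_le (hn : 1 < (n₁ : ℝ) + n₂) (hd : 0 < ds + dm + dθ)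
    (hmod : Model μ ds dm dθ P M Θ w x) (hbnd : Bounded M Θ αm αθ η)
    (hreg : LossRegular μ l M Θ x αm αl L) (hmom : MomentBound μ l M x αθ αl L η δ αδ)
    (hest : IsEstimator μ ds dm dθ αm αθ η l w x Mhat Θhat) {c t : ℝ} (hc : 0 < c)
    (ht : 1 ≤ t) :
    μ {ω | (∀ i j, |deriv (l i j (x i j ω)) (M i j)| ≤ αδ * Real.sqrt ((n₁ : ℝ) + n₂)) ∧
        t ≤ frob (err Mhat Θhat M Θ ω) ^ (2 + c) / (((n₁ : ℝ) + n₂) ^ (1 + c) *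
          maxNorm (err Mhat Θhat M Θ ω) ^ (1 + c))} ≤
      ENNReal.ofReal (24 * (c + 1 / c) * Real.exp (-(1 / 256 * (αh αθ η αl /
        (cδ η αδ L αm * ((ds + dm + dθ : ℕ) : ℝ) ^ (3 / 2 : ℝ)
          * ((n₁ : ℝ) + n₂) ^ (1 / 2 : ℝ)) * t)))) := by
  set N : ℝ := (n₁ : ℝ) + n₂ with hN
  have hN0 : 0 < N := by linarith
  have hδ := hmom.pos_δ
  set D := cδ η αδ L αm * ((ds + dm + dθ : ℕ) : ℝ) ^ (3 / 2 : ℝ) * N ^ (1 / 2 : ℝ) with hD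
  have hD0 : 0 < D := by
    have h1 : 0 < cδ η αδ L αm := by
      linarith [one_le_cδ (η := η) (αδ := αδ) (L := L) (αm := αm)]
    have h2 : (0 : ℝ) < ((ds + dm + dθ : ℕ) : ℝ) := Nat.cast_pos.2 hd
    positivity
  have hah := αh_pos (αθ := αθ) hbnd.weight_pos hreg.pos_αl
  set y := 1 / 256 * (αh αθ η αl / D * t) with hy
  have hy0 : 0 < y := by positivity
  have hcc : 2 ≤ c + 1 / c := by
    rw [← sub_nonneg, show c + 1 / c - 2 = (c - 1) ^ 2 / c by field_simp; ring]
    positivity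
  rcases lt_or_ge y 1 with hsmall | hlarge
  · -- here the bound exceeds `1`, since `48 * exp (-1) > 1`
    refine prob_le_one.trans ?_
    rw [← ENNReal.ofReal_one]
    refine ENNReal.ofReal_le_ofReal ?_
    have h1 : Real.exp (-1) ≤ Real.exp (-y) := Real.exp_le_exp.2 (by linarith)
    have h2 : Real.exp 1 * Real.exp (-1) = 1 := by rw [← Real.exp_add]; norm_num
    have h3 := Real.exp_one_lt_d9
    have h4 : 1 / 3 ≤ Real.exp (-1) := by nlinarith [Real.exp_pos (-1)]
    nlinarith
  · have hk : ∀ k : ℕ, μ {ω |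
        (∀ i j, |deriv (l i j (x i j ω)) (M i j)| ≤ αδ * Real.sqrt N) ∧
        t * (2 ^ k : ℝ) ^ (1 + c) ≤ frob (err Mhat Θhat M Θ ω) ∧
        (1 / 2 : ℝ) ^ (k + 1) * N * maxNorm (err Mhat Θhat M Θ ω) ≤
          frob (err Mhat Θhat M Θ ω)} ≤
        ENNReal.ofReal (8 * Real.exp (-y) * Real.exp (-(y * (c / 2))) ^ k) := by
      intro k
      have hp1 : (1 : ℝ) ≤ (2 ^ k : ℝ) ^ (1 + c) :=
        Real.one_le_rpow (one_le_pow₀ (by norm_num)) (by linarith)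
      have hlt : N ^ (-(δ / 2)) < t * (2 ^ k : ℝ) ^ (1 + c) := by
        have := Real.rpow_lt_one_of_one_lt_of_neg hn (show -(δ / 2) < 0 by linarith)
        nlinarith
      refine (measure_flat_le hn.le hd hmod hbnd hreg hmom hest
        (c := (1 / 2 : ℝ) ^ (k + 1)) (by positivity) hlt).trans ?_
      refine ENNReal.ofReal_le_ofReal ?_
      rw [← hN, ← hD, mul_assoc 8, ← Real.exp_nat_mul, ← Real.exp_add]
      refine mul_le_mul_of_nonneg_left (Real.exp_le_exp.2 ?_) (by norm_num)
      have e : 1 / 128 * (αh αθ η αl * (1 / 2 : ℝ) ^ (k + 1) / D *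
          (t * (2 ^ k : ℝ) ^ (1 + c))) = y * (2 ^ k : ℝ) ^ c := by
        rw [Real.rpow_add (by positivity), Real.rpow_one, hy, _root_.one_div_pow, pow_succ]
        field_simp
        ring
      rw [e]
      have := mul_le_mul_of_nonneg_left (two_pow_rpow_lower k hc) hy0.le
      linarith
    have hu : 0 < y * (c / 2) := by positivity
    have hρ1 : Real.exp (-(y * (c / 2))) < 1 := by
      rw [← Real.exp_zero]
      exact Real.exp_lt_exp.2 (by linarith)
    calc _ ≤ μ (⋃ k : ℕ, {ω |
        (∀ i j, |deriv (l i j (x i j ω)) (M i j)| ≤ αδ * Real.sqrt N) ∧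
        t * (2 ^ k : ℝ) ^ (1 + c) ≤ frob (err Mhat Θhat M Θ ω) ∧
        (1 / 2 : ℝ) ^ (k + 1) * N * maxNorm (err Mhat Θhat M Θ ω) ≤
          frob (err Mhat Θhat M Θ ω)}) := by
          refine measure_mono ?_
          rintro ω ⟨h1, h2⟩
          have hne : err Mhat Θhat M Θ ω ≠ 0 := by
            intro h0
            rw [h0, frob_zero, Real.zero_rpow (by linarith), zero_div] at h2
            linarith
          obtain ⟨k, hk1, hk2⟩ := exists_dyadic_of_le_weighted hN0 (maxNorm_pos hne)
            (frob_pos hne) (frob_le_mul_maxNorm _) hc h2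
          exact Set.mem_iUnion.2 ⟨k, h1, hk1, hk2⟩
      _ ≤ ∑' k : ℕ, ENNReal.ofReal (8 * Real.exp (-y) * Real.exp (-(y * (c / 2))) ^ k) :=
          (measure_iUnion_le _).trans (ENNReal.tsum_le_tsum hk)
      _ ≤ ENNReal.ofReal (8 * Real.exp (-y) / (1 - Real.exp (-(y * (c / 2))))) :=
          tsum_ofReal_geometric_le (by positivity) (Real.exp_pos _).le hρ1
      _ ≤ _ := by
          refine ENNReal.ofReal_le_ofReal ?_
          rw [div_le_iff₀ (by linarith)]
          set ρ := Real.exp (-(y * (c / 2))) with hρ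
          -- `1 - exp (-v) ≥ v / (1 + v)` at `v = c / 2`, a lower bound for `y * (c / 2)`
          have h1 : ρ ≤ 1 / (1 + c / 2) := by
            rw [hρ, Real.exp_neg, ← one_div]
            refine one_div_le_one_div_of_le (by positivity) ?_
            have := Real.add_one_le_exp (y * (c / 2))
            nlinarith
          have h2 : c / (2 + c) ≤ 1 - ρ := by
            have : 1 - 1 / (1 + c / 2) = c / (2 + c) := by field_simp; ring
            linarith
          have h3 : 8 ≤ 24 * (c + 1 / c) * (c / (2 + c)) := by
            rw [show 24 * (c + 1 / c) * (c / (2 + c)) = 24 * (c ^ 2 + 1) / (2 + c) by field_simp,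
              le_div_iff₀ (by linarith)]
            nlinarith [sq_nonneg (c - 1)]
          have h4 : 8 ≤ 24 * (c + 1 / c) * (1 - ρ) :=
            h3.trans (mul_le_mul_of_nonneg_left h2 (by positivity))
          calc 8 * Real.exp (-y) ≤ 24 * (c + 1 / c) * (1 - ρ) * Real.exp (-y) :=
                mul_le_mul_of_nonneg_right h4 (Real.exp_pos _).le
            _ = _ := by ring

end Tail

theorem div_two_rpow_le {c t : ℝ} (hc : 0 < c) (ht : 1 ≤ t) : (t / 2) ^ (2 / (2 + c)) ≤ t := by
  have hp : 2 / (2 + c) ≤ 1 := (div_le_one (by linarith)).2 (by linarith)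
  rcases le_total (t / 2) 1 with h | h
  · exact (Real.rpow_le_one (by linarith) h (by positivity)).trans ht
  · calc (t / 2) ^ (2 / (2 + c)) ≤ (t / 2) ^ (1 : ℝ) := Real.rpow_le_rpow_of_exponent_le h hp
      _ ≤ t := by rw [Real.rpow_one]; linarith

end SharedFactor

end

/-! ### The two tail bounds -/

theorem mainTheorem6 :
    ∃ C₁ C₂ : ℝ, 0 < C₁ ∧ 0 < C₂ ∧
      ∀ (n₁ n₂ ds dm dθ : ℕ), 0 < n₁ → 0 < n₂ → 0 < ds + dm + dθ →
      ∀ (Ω : Type*) [MeasurableSpace Ω] (μ : Measure Ω) [IsProbabilityMeasure μ]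
        (P : Fin n₁ → Fin n₂ → ℝ → Measure ℝ)
        (M Θ : Matrix (Fin n₁) (Fin n₂) ℝ)
        (w x : Fin n₁ → Fin n₂ → Ω → ℝ)
        (l : Fin n₁ → Fin n₂ → ℝ → ℝ → ℝ)
        (αm αθ η αl L δ αδ : ℝ)
        (Mhat Θhat : Ω → Matrix (Fin n₁) (Fin n₂) ℝ),
      SharedFactor.Model μ ds dm dθ P M Θ w x →
      SharedFactor.Bounded M Θ αm αθ η →
      SharedFactor.LossRegular μ l M Θ x αm αl L →
      SharedFactor.MomentBound μ l M x αθ αl L η δ αδ →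
      SharedFactor.IsEstimator μ ds dm dθ αm αθ η l w x Mhat Θhat →
      ∀ c : ℝ, 0 < c →
        (∀ t : ℝ, ((n₁ : ℝ) + n₂) ^ (-(δ / 2)) < t →
          μ.real {ω | t ≤ SharedFactor.frob (SharedFactor.err Mhat Θhat M Θ ω)} ≤
            μ.real {ω | SharedFactor.err Mhat Θhat M Θ ω ≠ 0 ∧
              SharedFactor.frob (SharedFactor.err Mhat Θhat M Θ ω) /
                (((n₁ : ℝ) + n₂) * SharedFactor.maxNorm (SharedFactor.err Mhat Θhat M Θ ω)) < c}
            + (n₁ : ℝ) * n₂ / ((n₁ : ℝ) + n₂) ^ (2 + δ / 2)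
            + C₁ * Real.exp (-(C₂ * (SharedFactor.αh αθ η αl * c /
                (SharedFactor.cδ η αδ L αm * ((ds + dm + dθ : ℕ) : ℝ) ^ (3 / 2 : ℝ)
                  * ((n₁ : ℝ) + n₂) ^ (1 / 2 : ℝ)) * t)))) ∧
        (∀ t : ℝ, 1 ≤ t →
          μ.real {ω | t ≤ SharedFactor.frob (SharedFactor.err Mhat Θhat M Θ ω) ^ (2 + c) /
              (((n₁ : ℝ) + n₂) ^ (1 + c) *
                SharedFactor.maxNorm (SharedFactor.err Mhat Θhat M Θ ω) ^ (1 + c))} ≤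
            (n₁ : ℝ) * n₂ / ((n₁ : ℝ) + n₂) ^ (2 + δ / 2)
            + C₁ * (c + 1 / c) * Real.exp (-(C₂ * (SharedFactor.αh αθ η αl /
                (SharedFactor.cδ η αδ L αm * ((ds + dm + dθ : ℕ) : ℝ) ^ (3 / 2 : ℝ)
                  * ((n₁ : ℝ) + n₂) ^ (1 / 2 : ℝ)) * (t / 2) ^ (2 / (2 + c))))) ) := by
  refine ⟨24, 1 / 256, by norm_num, by norm_num, ?_⟩
  intro n₁ n₂ ds dm dθ hn₁ hn₂ hd Ω _ μ _ P M Θ w x l αm αθ η αl L δ αδ Mhat Θhat hmod hbnd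
    hreg hmom hest c hc
  have hN1 : 1 < (n₁ : ℝ) + n₂ := by
    have h1 : (1 : ℝ) ≤ n₁ := Nat.one_le_cast.2 hn₁
    have h2 : (1 : ℝ) ≤ n₂ := Nat.one_le_cast.2 hn₂
    linarith
  have hN0 : 0 < (n₁ : ℝ) + n₂ := by linarith
  have hbad := SharedFactor.measureReal_exists_not_truncated_le hN0 hmod hreg hmom
  have hah := SharedFactor.αh_pos (αθ := αθ) hbnd.weight_pos hreg.pos_αl
  have hcδ : 0 < SharedFactor.cδ η αδ L αm := zero_lt_one.trans_le SharedFactor.one_le_cδ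
  refine ⟨fun t ht => ?_, fun t ht => ?_⟩
  · have ht0 : 0 < t := (Real.rpow_pos_of_pos hN0 _).trans ht
    have hflat := ENNReal.toReal_le_of_le_ofReal (by positivity)
      (SharedFactor.measure_flat_le hN1.le hd hmod hbnd hreg hmom hest hc ht)
    rw [← measureReal_def] at hflat
    refine (measureReal_mono ?_).trans ((measureReal_union_le _ _).trans (add_le_add
      ((measureReal_union_le _ _).trans (add_le_add le_rfl hbad)) (hflat.trans ?_)))
    · intro ω hω
      by_cases htr : ∀ i j, |deriv (l i j (x i j ω)) (M i j)| ≤ αδ * Real.sqrt ((n₁ : ℝ) + n₂)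
      · have hF : t ≤ SharedFactor.frob (SharedFactor.err Mhat Θhat M Θ ω) := hω
        have hne : SharedFactor.err Mhat Θhat M Θ ω ≠ 0 := by
          intro h0
          rw [h0, SharedFactor.frob_zero] at hF
          linarith
        have hX := SharedFactor.maxNorm_pos hne
        rcases lt_or_ge (SharedFactor.frob (SharedFactor.err Mhat Θhat M Θ ω) /
          (((n₁ : ℝ) + n₂) * SharedFactor.maxNorm (SharedFactor.err Mhat Θhat M Θ ω))) c
          with hr | hr
        · exact Or.inl (Or.inl ⟨hne, hr⟩)
        · rw [le_div_iff₀ (by positivity), ← mul_assoc] at hr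
          exact Or.inr ⟨htr, hF, hr⟩
      · exact Or.inl (Or.inr htr)
    · refine mul_le_mul (by norm_num) (Real.exp_le_exp.2 (neg_le_neg ?_)) (Real.exp_pos _).le
        (by norm_num)
      refine mul_le_mul_of_nonneg_right (by norm_num) ?_
      positivity
  · have hweighted := ENNReal.toReal_le_of_le_ofReal (by positivity)
      (SharedFactor.measure_weighted_le hN1 hd hmod hbnd hreg hmom hest hc ht)
    rw [← measureReal_def] at hweighted
    refine (measureReal_mono ?_).trans ((measureReal_union_le _ _).trans (add_le_add hbad
      (hweighted.trans ?_)))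
    · intro ω hω
      by_cases htr : ∀ i j, |deriv (l i j (x i j ω)) (M i j)| ≤ αδ * Real.sqrt ((n₁ : ℝ) + n₂)
      · exact Or.inr ⟨htr, hω⟩
      · exact Or.inl htr
    · refine mul_le_mul_of_nonneg_left (Real.exp_le_exp.2 (neg_le_neg ?_)) (by positivity)
      refine mul_le_mul_of_nonneg_left ?_ (by norm_num)
      refine mul_le_mul_of_nonneg_left (SharedFactor.div_two_rpow_le hc ht) ?_
      positivity
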